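/- Let $L$ be a first-order language, $\kappa$ an uncountable cardinal, and $\mathfrak C$ a monster model (of a complete $L$-theory) that is $\kappa$-saturated and strongly $\kappa$-homogeneous. Let $x$ be a tuple of fewer than $\kappa$ variables, $A\subseteq\mathfrak C$ a set with $|A|<\kappa$, $p(x)$ a partial type over $A$ (a consistent set of formulas with parameters in $A$), and $\alpha$ an ordinal with $|\alpha|<\kappa$. Consistency of a set of formulas over $\mathfrak C$ means finite satisfiability in $\mathfrak C$. Write $\omega^{<\alpha}$ for the set of functions $s$ from an ordinal $|s|<\alpha$ to $\omega$. A family of formulas $(\psi_i(x):i<\omega)$ is $k$-inconsistent if any $k$ members with distinct indices are inconsistent. A formula $\varphi(x,a)$ (with $\varphi(x,y)\in L$, $a$ a finite tuple) divides over $B$ if for some $k<\omega$ there are tuples $a_i\models \mathrm{tp}(a/B)$, $i<\omega$, such that $(\varphi(x,a_i):i<\omega)$ is $k$-inconsistent; a partial type divides over $B$ if it implies a formula that divides over $B$. We write $\alpha_+\le DD(p)$ if there exist finite tuples of parameters $(a_{s,i}:s\in\omega^{<\alpha},i<\omega)$, formulas $(\varphi_j(x,y_j)\in L:j<\alpha)$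 and numbers $(k_j\in\omega:j<\alpha)$ such that for each $s\in\omega^{<\alpha}$ the family $(\varphi_{|s|}(x,a_{s,i}):i<\omega)$ is $k_{|s|}$-inconsistent, and for each $f:\alpha\to\omega$ the set $p(x)\cup\{\varphi_i(x,a_{f\restriction i,f(i)}):i<\alpha\}$ is consistent. Then the following six conditions are equivalent: 1. $\alpha_+\le DD(p)$. 2. There exist parameters $(a_{s,i}:s\in\omega^{<\alpha},i<\omega)$ and formulas $(\varphi_j(x,y_j)\in L:j<\alpha)$ such that (a) for each $s\in\omega^{<\alpha}$, $(a_{s,i}:i<\omega)$ is indiscernible over $A\cup\{a_{s\restriction j,s(j)}:j<|s|\}$; (b) for each $s\in\omega^{<\alpha}$, $\{\varphi_{|s|}(x,a_{s,i}):i<\omega\}$ is inconsistent; (c) for each $f:\alpha\to\omega$, $p(x)\cup\{\varphi_i(x,a_{f\restriction i,f(i)}):i<\alpha\}$ is consistent. 3. There exist parameters $(a_{s,i}:s\in\omega^{<\alpha},i<\omega)$ and formulas $(\varphi_s(x,y_s)\in L:s\in\omega^{<\alpha})$ such that (a) for each $s\in\omega^{<\alpha}$, $(a_{s,i}:i<\omega)$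 is indiscernible over $A\cup\{a_{s\restriction j,s(j)}:j<|s|\}$; (b) for each $s\in\omega^{<\alpha}$, $\{\varphi_s(x,a_{s,i}):i<\omega\}$ is inconsistent; (c) for each $f:\alpha\to\omega$, $p(x)\cup\{\varphi_{f\restriction i}(x,a_{f\restriction i,f(i)}):i<\alpha\}$ is consistent. 4. There is a dividing sequence of depth $\alpha$ in $p$ over $A$: formulas $(\varphi_i(x,x_i)\in L:i<\alpha)$ and finite tuples $(a_i:i<\alpha)$ such that $p(x)\cup\{\varphi_i(x,a_i):i<\alpha\}$ is consistent and, for each $i<\alpha$, $\varphi_i(x,a_i)$ divides over $A\cup\{a_j:j<i\}$. 5. There is a dividing chain of complete types of depth $\alpha$ in $p$ over $A$: sets $A_i$ with $|A_i|<\kappa$ and complete types $p_i(x)$ over $A_i$, $i<\alpha$, such that $p\subseteq p_0$, $A\subseteq A_0$, $p_0$ divides over $A$, and for every $0<i<\alpha$, $\bigcup_{j<i}p_j\subseteq p_i$, $\bigcup_{j<i}A_j\subseteq A_i$ and $p_i$ divides over $\bigcup_{j<i}A_j$. 6. There is a dividing chain of partial types of depth $\alpha$ in $p$ over $A$: the same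 as in 5, with partial types $p_i$ over $A_i$ in place of complete types. In particular, since condition 1 does not mention $A$, none of the conditions 2–6 depends on $A$: if $B$ is another set with $|B|<\kappa$ such that $p$ is a partial type over $B$, then each of the conditions 2–6 holds for $A$ if and only if it holds for $B$. -/

import Mathlib

open FirstOrder Cardinal

universe u v w

namespace DividingDepth

section Types

variable {L : FirstOrder.Language.{u, v}} {M : Type w} [L.Structure M] {X : Type w}

/-- The formula `φ(x, a)` over `M`: the variables `y` of `φ(x, y)` are replaced by (the constants
naming) the elements of the finite tuple `a`. -/
def inst {n : ℕ} (φ : L.Formula (X ⊕ Fin n)) (a : Fin n → M) : L[[M]].Formula X :=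
  FirstOrder.Language.BoundedFormula.constantsVarsEquiv.symm
    (FirstOrder.Language.Formula.relabel (Sum.elim Sum.inr (fun j => Sum.inl (a j))) φ : L.Formula (M ⊕ X))

theorem realize_inst {n : ℕ} (φ : L.Formula (X ⊕ Fin n)) (a : Fin n → M) (c : X → M) :
    (inst φ a).Realize c ↔ φ.Realize (Sum.elim c a) := by
  have h := FirstOrder.Language.BoundedFormula.realize_constantsVarsEquiv (M := M) (φ := inst φ a) (v := c)
    (xs := (default : Fin 0 → M))
  unfold FirstOrder.Language.Formula.Realize
  rw [← h]
  simp only [inst, Equiv.apply_symm_apply]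
  refine (FirstOrder.Language.Formula.realize_relabel (φ := φ)).trans (iff_of_eq ?_)
  congr 1
  funext z
  rcases z with z | z
  · rfl
  · rfl

/-- The `L(M)`-formula `φ` is a formula over `A`, i.e. it is an `L(A)`-formula. -/
def FormulaOver (A : Set M) (φ : L[[M]].Formula X) : Prop :=
  ∃ ψ : L[[A]].Formula X, (L.lhomWithConstantsMap ((↑) : A → M)).onFormula ψ = φ

/-- A set of `L(M)`-formulas is consistent (with the elementary diagram of `M`), i.e. finitely
satisfiable in `M`. -/
def Consistent (p : Set (L[[M]].Formula X)) : Prop :=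
  ∀ s : Finset (L[[M]].Formula X), ↑s ⊆ p → ∃ c : X → M, ∀ φ ∈ s, φ.Realize c

/-- `p` implies `φ`, modulo the elementary diagram of `M`. -/
def Implies (p : Set (L[[M]].Formula X)) (φ : L[[M]].Formula X) : Prop :=
  ∃ s : Finset (L[[M]].Formula X), ↑s ⊆ p ∧
    ∀ c : X → M, (∀ ψ ∈ s, ψ.Realize c) → φ.Realize c

/-- `p(x)` is a partial type over `A`. -/
def IsPartialType (A : Set M) (p : Set (L[[M]].Formula X)) : Prop :=
  Consistent p ∧ ∀ φ ∈ p, FormulaOver A φ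

/-- `p(x)` is a complete type over `A`. -/
def IsCompleteType (A : Set M) (p : Set (L[[M]].Formula X)) : Prop :=
  IsPartialType A p ∧ ∀ φ : L[[M]].Formula X, FormulaOver A φ → φ ∈ p ∨ φ.not ∈ p

/-- The family `(φ_i : i < ω)` is `k`-inconsistent: any `k` of its members, with distinct indices,
are inconsistent. -/
def KInconsistent (k : ℕ) (φ : ℕ → L[[M]].Formula X) : Prop :=
  ∀ s : Finset ℕ, s.card = k → ¬ Consistent (φ '' ↑s)

variable (L) in
/-- `tp(a/A) = tp(b/A)`. -/
def SameType (A : Set M) {n : ℕ} (a b : Fin n → M) : Prop :=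
  ∀ ψ : L[[A]].Formula (Fin n), ψ.Realize a ↔ ψ.Realize b

variable (L) in
/-- The sequence `(a_i : i < ω)` of `n`-tuples is indiscernible over `A`. -/
def Indiscernible (A : Set M) {n : ℕ} (a : ℕ → Fin n → M) : Prop :=
  ∀ (m : ℕ) (i j : Fin m → ℕ), StrictMono i → StrictMono j →
    ∀ ψ : L[[A]].Formula (Fin m × Fin n),
      ψ.Realize (fun z => a (i z.1) z.2) ↔ ψ.Realize (fun z => a (j z.1) z.2)

/-- `φ(x, a)` divides over `A`. -/
def FormulaDivides (A : Set M) {n : ℕ} (φ : L.Formula (X ⊕ Fin n)) (a : Fin n → M) : Prop :=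
  ∃ (k : ℕ) (b : ℕ → Fin n → M),
    (∀ i, SameType L A (b i) a) ∧ KInconsistent k (fun i => inst φ (b i))

/-- `p(x)` divides over `A`: it implies a formula that divides over `A`. -/
def TypeDivides (A : Set M) (p : Set (L[[M]].Formula X)) : Prop :=
  ∃ (n : ℕ) (φ : L.Formula (X ⊕ Fin n)) (a : Fin n → M),
    Implies p (inst φ a) ∧ FormulaDivides A φ a

end Types

section Monster

variable (L : FirstOrder.Language.{u, v}) (M : Type w) [L.Structure M]

/-- Every `1`-type over fewer than `κ` parameters is realized in `M`. -/
def IsSaturated (κ : Cardinal.{w}) : Prop :=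
  ∀ (A : Set M) (q : Set (L[[M]].Formula PUnit.{w + 1})), #A < κ → IsPartialType A q →
    ∃ c : PUnit.{w + 1} → M, ∀ φ ∈ q, φ.Realize c

/-- Every elementary map defined on fewer than `κ` elements of `M` extends to an automorphism. -/
def IsStronglyHomogeneous (κ : Cardinal.{w}) : Prop :=
  ∀ (A : Set M) (f : A → M), #A < κ →
    (∀ φ : L.Formula A, φ.Realize ((↑) : A → M) ↔ φ.Realize f) →
    ∃ g : M ≃[L] M, ∀ a : A, g (a : M) = f a

/-- `M` is a monster model (of its complete theory) with respect to the uncountable cardinal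
`κ`. -/
structure IsMonster (κ : Cardinal.{w}) : Prop where
  nonempty : Nonempty M
  aleph0_lt : ℵ₀ < κ
  saturated : IsSaturated L M κ
  homogeneous : IsStronglyHomogeneous L M κ

end Monster

section Trees

variable {M : Type w} {α : Ordinal.{w}}

/-- The restriction `s ↾ j` of a sequence `s` of length `i` to `j < i`. The elements `i` of
`α.ToType` are the ordinals below `α`, so a node `s ∈ ω^{<α}` of length `i` is a map
`Set.Iio i → ℕ`. -/
def restr {i : α.ToType} (s : Set.Iio i → ℕ) (j : Set.Iio i) : Set.Iio (j : α.ToType) → ℕ :=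
  fun l => s ⟨l, Set.mem_Iio.2 (lt_trans (Set.mem_Iio.1 l.2) (Set.mem_Iio.1 j.2))⟩

/-- The restriction `f ↾ i` of `f : α → ω`. -/
def cut (f : α.ToType → ℕ) (i : α.ToType) : Set.Iio i → ℕ := fun j => f j

/-- The set of (entries of) the parameters `a_{s ↾ j, s(j)}`, `j < |s|`. Here `a i s m` is
`a_{s,m}`, for `s` of length `i`. -/
def earlier {n : (i : α.ToType) → (Set.Iio i → ℕ) → ℕ}
    (a : (i : α.ToType) → (s : Set.Iio i → ℕ) → ℕ → Fin (n i s) → M)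
    {i : α.ToType} (s : Set.Iio i → ℕ) : Set M :=
  ⋃ j : Set.Iio i, Set.range (a j (restr s j) (s j))

end Trees

section Conditions

variable {L : FirstOrder.Language.{u, v}} {M : Type w} [L.Structure M] {X : Type w}

/-- `α₊ ≤ DD(p)`: there is a tree of parameters of depth `α`, with formulas `φ_i` and numbers `k_i`
for `i < α`, whose rows are `k_i`-inconsistent and whose branches are consistent with `p`. -/
def PlusLeDD (p : Set (L[[M]].Formula X)) (α : Ordinal.{w}) : Prop :=
  ∃ (n : α.ToType → ℕ)
    (a : (i : α.ToType) → (Set.Iio i → ℕ) → ℕ → Fin (n i) → M)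
    (φ : (i : α.ToType) → L.Formula (X ⊕ Fin (n i)))
    (k : α.ToType → ℕ),
    (∀ (i : α.ToType) (s : Set.Iio i → ℕ), KInconsistent (k i) (fun m => inst (φ i) (a i s m))) ∧
    ∀ f : α.ToType → ℕ,
      Consistent (p ∪ Set.range (fun i => inst (φ i) (a i (cut f i) (f i))))

/-- A tree of depth `α` whose rows are indiscernible over `A` and the earlier part of the branch,
with one formula for each level. -/
def IndiscernibleTree (A : Set M) (p : Set (L[[M]].Formula X)) (α : Ordinal.{w}) : Prop :=
  ∃ (n : α.ToType → ℕ)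
    (a : (i : α.ToType) → (Set.Iio i → ℕ) → ℕ → Fin (n i) → M)
    (φ : (i : α.ToType) → L.Formula (X ⊕ Fin (n i))),
    (∀ (i : α.ToType) (s : Set.Iio i → ℕ),
      Indiscernible L (A ∪ earlier (n := fun i _ => n i) a s) (a i s)) ∧
    (∀ (i : α.ToType) (s : Set.Iio i → ℕ),
      ¬ Consistent (Set.range (fun m => inst (φ i) (a i s m)))) ∧
    ∀ f : α.ToType → ℕ,
      Consistent (p ∪ Set.range (fun i => inst (φ i) (a i (cut f i) (f i))))

/-- A tree of depth `α` whose rows are indiscernible over `A` and the earlier part of the branch,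
with one formula for each node. -/
def IndiscernibleFormulaTree (A : Set M) (p : Set (L[[M]].Formula X)) (α : Ordinal.{w}) : Prop :=
  ∃ (n : (i : α.ToType) → (Set.Iio i → ℕ) → ℕ)
    (a : (i : α.ToType) → (s : Set.Iio i → ℕ) → ℕ → Fin (n i s) → M)
    (φ : (i : α.ToType) → (s : Set.Iio i → ℕ) → L.Formula (X ⊕ Fin (n i s))),
    (∀ (i : α.ToType) (s : Set.Iio i → ℕ), Indiscernible L (A ∪ earlier a s) (a i s)) ∧
    (∀ (i : α.ToType) (s : Set.Iio i → ℕ),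
      ¬ Consistent (Set.range (fun m => inst (φ i s) (a i s m)))) ∧
    ∀ f : α.ToType → ℕ,
      Consistent (p ∪ Set.range (fun i => inst (φ i (cut f i)) (a i (cut f i) (f i))))

/-- There is a dividing sequence of depth `α` in `p` over `A`. -/
def DividingSequence (A : Set M) (p : Set (L[[M]].Formula X)) (α : Ordinal.{w}) : Prop :=
  ∃ (n : α.ToType → ℕ)
    (φ : (i : α.ToType) → L.Formula (X ⊕ Fin (n i)))
    (a : (i : α.ToType) → Fin (n i) → M),
    Consistent (p ∪ Set.range (fun i => inst (φ i) (a i))) ∧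
    ∀ i : α.ToType,
      FormulaDivides (A ∪ ⋃ j : Set.Iio i, Set.range (a (j : α.ToType))) (φ i) (a i)

/-- The conditions common to the two kinds of dividing chains: the types `p_i` over `A_i`, `i < α`,
start above `p` and `A`, they increase, `p_0` divides over `A`, and `p_i` divides over `A_{<i}`
for `0 < i < α`. -/
def IsDividingChain (A : Set M) (p : Set (L[[M]].Formula X)) {α : Ordinal.{w}}
    (B : α.ToType → Set M) (q : α.ToType → Set (L[[M]].Formula X)) : Prop :=
  (∀ i : α.ToType, IsMin i → p ⊆ q i ∧ A ⊆ B i ∧ TypeDivides A (q i)) ∧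
  ∀ i : α.ToType, ¬ IsMin i →
    (⋃ j : Set.Iio i, q j) ⊆ q i ∧ (⋃ j : Set.Iio i, B j) ⊆ B i ∧
      TypeDivides (⋃ j : Set.Iio i, B j) (q i)

/-- There is a dividing chain of complete types of depth `α` in `p` over `A`; the parameter sets
have fewer than `κ` elements. -/
def CompleteDividingChain (κ : Cardinal.{w}) (A : Set M) (p : Set (L[[M]].Formula X))
    (α : Ordinal.{w}) : Prop :=
  ∃ (B : α.ToType → Set M) (q : α.ToType → Set (L[[M]].Formula X)),
    (∀ i, #(B i) < κ ∧ IsCompleteType (B i) (q i)) ∧ IsDividingChain A p B q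

/-- There is a dividing chain of partial types of depth `α` in `p` over `A`; the parameter sets
have fewer than `κ` elements. -/
def PartialDividingChain (κ : Cardinal.{w}) (A : Set M) (p : Set (L[[M]].Formula X))
    (α : Ordinal.{w}) : Prop :=
  ∃ (B : α.ToType → Set M) (q : α.ToType → Set (L[[M]].Formula X)),
    (∀ i, #(B i) < κ ∧ IsPartialType (B i) (q i)) ∧ IsDividingChain A p B q

end Conditions

end DividingDepth

/-! Condition 4, the dividing sequence, is the hub.

From a dividing sequence `(a_i)` to a tree (`exists_tree`): each instance of dividing is witnessed
by a sequence `(c_{i,m})` of conjugates of `a_i` that is indiscernible over `A` and the `a_j`, `j <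
i`. By recursion on levels, a node `s` of length `i` receives an automorphism over `A` carrying
every `a_j`, `j < i`, to the parameter chosen by `s` at level `j`; its image of `(c_{i,m})` is the
row at `s`. Such automorphisms exist because types have finite character and the model is strongly
homogeneous. Finite parts of any branch are conjugate over `A` to parts of `(a_i)`, hence consistent
with `p`. This yields conditions 1 and 2 together.

From an arbitrary tree to a dividing sequence (`dividingSequence_of_plusLeDD`): only finitely many
formulas matter at a time, so by pigeonhole each row has a subsequence whose entries look alike over
the earlier part of the branch. Following first entries of these subsequences and applying
compactness gives a branch each of whose parameters starts a row of conjugates over its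
predecessors.

For chains, the types over `A` and the `a_j`, `j ≤ i`, of one realization of the whole sequence form
a chain. Conversely, a type that divides implies a dividing formula with parameters in its own
domain, and these formulas form a sequence.

Independence of `A` follows since condition 1 does not mention it. -/

namespace DividingDepth

open FirstOrder.Language

/-! ### Predicates definable with parameters, in possibly infinitely many variables -/

section Definable

variable {L : FirstOrder.Language.{u, v}} {M : Type w} [L.Structure M]

variable (L) in
/-- The predicate `P` on `Y`-tuples is definable by a formula with parameters in `A`. -/
def DefOver {Y : Type*} (A : Set M) (P : (Y → M) → Prop) : Prop :=
  ∃ φ : L.Formula (A ⊕ Y), ∀ v, P v ↔ φ.Realize (Sum.elim (↑) v)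

variable {Y Z : Type*} {A B : Set M} {P Q : (Y → M) → Prop}

theorem defOver_iff_exists_withConstants :
    DefOver L A P ↔ ∃ ψ : L[[A]].Formula Y, ∀ v, P v ↔ ψ.Realize v := by
  have h := Set.definable_iff_exists_formula_sum (L := L) (A := A) (s := {v | P v})
  unfold Set.Definable at h
  constructor
  · rintro ⟨φ, hφ⟩
    obtain ⟨ψ, hψ⟩ := h.2 ⟨φ, Set.ext hφ⟩
    exact ⟨ψ, fun v => iff_of_eq (congrArg (v ∈ ·) hψ)⟩
  · rintro ⟨ψ, hψ⟩
    obtain ⟨φ, hφ⟩ := h.1 ⟨ψ, Set.ext hψ⟩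
    exact ⟨φ, fun v => iff_of_eq (congrArg (v ∈ ·) hφ)⟩

theorem DefOver.congr (h : DefOver L A P) (hPQ : ∀ v, Q v ↔ P v) : DefOver L A Q := by
  obtain ⟨φ, hφ⟩ := h
  exact ⟨φ, fun v => (hPQ v).trans (hφ v)⟩

theorem DefOver.of_realize {n : ℕ} (θ : L.Formula (Y ⊕ Fin n)) {b : Fin n → M}
    (hb : ∀ t, b t ∈ A) : DefOver L A fun v => θ.Realize (Sum.elim v b) := by
  refine ⟨θ.relabel (Sum.elim Sum.inr fun t => Sum.inl ⟨b t, hb t⟩), fun v => ?_⟩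
  rw [Formula.realize_relabel]
  refine iff_of_eq (congrArg _ ?_)
  funext z
  rcases z with z | z <;> rfl

/-- Substitution of parameters and variables for variables. -/
theorem DefOver.subst (h : DefOver L A P) (F : Y → B ⊕ Z) (hAB : A ⊆ B) :
    DefOver L B fun v : Z → M => P fun y => Sum.elim (↑) v (F y) := by
  obtain ⟨φ, hφ⟩ := h
  refine ⟨φ.relabel (Sum.elim (fun a => Sum.inl (Set.inclusion hAB a)) F), fun v => ?_⟩
  refine (hφ _).trans (Iff.trans (iff_of_eq (congrArg _ ?_)) Formula.realize_relabel.symm)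
  funext z
  rcases z with z | z <;> rfl

theorem DefOver.mono (h : DefOver L A P) (hAB : A ⊆ B) : DefOver L B P :=
  h.subst Sum.inr hAB

theorem DefOver.comp (h : DefOver L A P) (f : Y → Z) :
    DefOver L A fun v : Z → M => P (v ∘ f) :=
  h.subst (fun y => Sum.inr (f y)) subset_rfl

theorem DefOver.not (h : DefOver L A P) : DefOver L A fun v => ¬ P v := by
  obtain ⟨φ, hφ⟩ := h
  exact ⟨φ.not, fun v => by simp only [Formula.realize_not, hφ]⟩

theorem DefOver.and (h : DefOver L A P) (h' : DefOver L A Q) :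
    DefOver L A fun v => P v ∧ Q v := by
  obtain ⟨φ, hφ⟩ := h
  obtain ⟨ψ, hψ⟩ := h'
  exact ⟨φ ⊓ ψ, fun v => by simp only [Formula.realize_inf, hφ, hψ]⟩

theorem DefOver.iff (h : DefOver L A P) (h' : DefOver L A Q) :
    DefOver L A fun v => P v ↔ Q v := by
  obtain ⟨φ, hφ⟩ := h
  obtain ⟨ψ, hψ⟩ := h'
  exact ⟨φ.iff ψ, fun v => by simp only [Formula.realize_iff, hφ, hψ]⟩

theorem defOver_true : DefOver L A fun _ : Y → M => True :=
  ⟨⊤, fun v => by simp⟩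

theorem defOver_eq (x y : Y) : DefOver L A fun v : Y → M => v x = v y :=
  ⟨(Term.equal (Term.var (Sum.inr x)) (Term.var (Sum.inr y))), fun v => by
    simp [Formula.realize_equal]⟩

theorem defOver_eq_const (x : Y) {a : M} (ha : a ∈ A) : DefOver L A fun v : Y → M => v x = a :=
  ⟨(Term.equal (Term.var (Sum.inr x)) (Term.var (Sum.inl ⟨a, ha⟩))), fun v => by
    simp [Formula.realize_equal]⟩

theorem DefOver.ball {ι : Type*} {R : ι → (Y → M) → Prop} (s : Finset ι)
    (h : ∀ i ∈ s, DefOver L A (R i)) : DefOver L A fun v => ∀ i ∈ s, R i v := by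
  classical
  induction s using Finset.induction_on with
  | empty => exact defOver_true.congr fun v => by simp
  | insert i s _ ih =>
    refine ((h i (Finset.mem_insert_self i s)).and
      (ih fun j hj => h j (Finset.mem_insert_of_mem hj))).congr fun v => ?_
    simp

/-- A definable predicate is defined by a formula with a finite tuple of parameters. -/
theorem DefOver.exists_fin (h : DefOver L A P) :
    ∃ (n : ℕ) (θ : L.Formula (Y ⊕ Fin n)) (b : Fin n → M), (∀ t, b t ∈ A) ∧
      ∀ v, P v ↔ θ.Realize (Sum.elim v b) := by
  classical
  obtain ⟨φ, hφ⟩ := h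
  let S : Finset A := φ.freeVarFinset.toLeft
  let e := S.equivFin
  have hS : ∀ z : φ.freeVarFinset, ∀ a : A, (z : A ⊕ Y) = Sum.inl a → a ∈ S := by
    rintro ⟨z, hz⟩ a rfl
    simpa [S] using hz
  let f : φ.freeVarFinset → Y ⊕ Fin S.card := fun z =>
    match h : (z : A ⊕ Y) with
    | Sum.inl a => Sum.inr (e ⟨a, hS z a h⟩)
    | Sum.inr y => Sum.inl y
  refine ⟨S.card, φ.restrictFreeVar f, fun t => (e.symm t : A), fun t => Subtype.coe_prop _,
    fun v => ?_⟩
  rw [hφ]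
  refine (BoundedFormula.realize_restrictFreeVar _ ?_).symm
  rintro ⟨z, hz⟩
  rcases z with a | y
  · simp [f]
  · simp [f]

/-- A definable predicate depends on finitely many coordinates only. -/
theorem DefOver.exists_finset (h : DefOver L A P) :
    ∃ T : Finset Y, ∀ v v', (∀ y ∈ T, v y = v' y) → (P v ↔ P v') := by
  classical
  obtain ⟨φ, hφ⟩ := h
  refine ⟨φ.freeVarFinset.toRight, fun v v' hv => ?_⟩
  rw [hφ, hφ]
  have key : ∀ v : Y → M, φ.Realize (Sum.elim (↑) v) ↔
      (BoundedFormula.restrictFreeVar φ id).Realize (fun z => Sum.elim (↑) v (z : A ⊕ Y))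
        (default : Fin 0 → M) :=
    fun v => (BoundedFormula.realize_restrictFreeVar (φ := φ) (f := id) _ fun _ => rfl).symm
  rw [key, key]
  refine iff_of_eq (congrArg (fun w => BoundedFormula.Realize _ w _) ?_)
  funext ⟨z, hz⟩
  rcases z with a | y
  · rfl
  · exact hv y (by simpa using hz)

/-- Definable predicates are closed under quantification over arbitrary tuples. -/
theorem DefOver.exists [Nonempty M] {P : (Y ⊕ Z → M) → Prop} (h : DefOver L A P) :
    DefOver L A fun v : Y → M => ∃ w : Z → M, P (Sum.elim v w) := by
  classical
  obtain ⟨T, hT⟩ := h.exists_finset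
  obtain ⟨φ, hφ⟩ := h
  let S : Finset Z := T.toRight
  obtain ⟨m₀⟩ := ‹Nonempty M›
  -- Coordinates outside the finite support `S` all collapse to `none`, so a finite block of
  -- quantifiers suffices.
  let r : Z → Option S := fun z => if hz : z ∈ S then some ⟨z, hz⟩ else none
  let ψ : L.Formula ((A ⊕ Y) ⊕ Option S) :=
    φ.relabel (Sum.elim (fun a => Sum.inl (Sum.inl a))
      (Sum.elim (fun y => Sum.inl (Sum.inr y)) fun z => Sum.inr (r z)))
  have hψ : ∀ (v : Y → M) (w : Option S → M),
      ψ.Realize (Sum.elim (Sum.elim (↑) v) w) ↔ P (Sum.elim v (w ∘ r)) := by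
    intro v w
    rw [hφ, Formula.realize_relabel]
    refine iff_of_eq (congrArg _ ?_)
    funext z
    rcases z with z | z | z <;> rfl
  refine ⟨ψ.iExs (Option S), fun v => ?_⟩
  rw [Formula.realize_iExs]
  constructor
  · rintro ⟨w, hw⟩
    refine ⟨fun s => s.elim m₀ fun z => w z, (hψ v _).2 ((hT _ _ ?_).1 hw)⟩
    rintro (y | z) hz
    · rfl
    · have : z ∈ S := by simpa [S] using hz
      simp [r, this]
  · rintro ⟨w, hw⟩
    exact ⟨w ∘ r, (hψ v w).1 hw⟩

/-- Parameters can be replaced by variables. -/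
theorem DefOver.exists_params {W : Type*} {e : W → M} (h : DefOver L (A ∪ Set.range e) P) :
    ∃ Q : (W ⊕ Y → M) → Prop, DefOver L A Q ∧ ∀ v, P v ↔ Q (Sum.elim e v) := by
  classical
  obtain ⟨φ, hφ⟩ := h
  have hr : ∀ c : ↥(A ∪ Set.range e), ∃ r : A ⊕ W, Sum.elim (↑) e r = (c : M) := by
    rintro ⟨c, hc | ⟨w, rfl⟩⟩
    · exact ⟨Sum.inl ⟨c, hc⟩, rfl⟩
    · exact ⟨Sum.inr w, rfl⟩
  choose r hr using hr
  let ψ : L.Formula (A ⊕ W ⊕ Y) :=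
    φ.relabel (Sum.elim (fun c => Sum.map id Sum.inl (r c)) fun y => Sum.inr (Sum.inr y))
  refine ⟨fun v => ψ.Realize (Sum.elim (↑) v), ⟨ψ, fun v => Iff.rfl⟩, fun v => ?_⟩
  rw [hφ]
  refine Iff.trans (iff_of_eq (congrArg _ ?_)) Formula.realize_relabel.symm
  funext z
  rcases z with c | y
  · simp only [Sum.elim_inl, Function.comp_apply]
    rw [← hr c]
    rcases r c with a | w <;> rfl
  · rfl

/-- Automorphisms transport definability. -/
theorem DefOver.of_image {g : M ≃[L] M} (h : DefOver L (g '' A) P) :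
    DefOver L A fun v => P (g ∘ v) := by
  obtain ⟨φ, hφ⟩ := h
  have hr : ∀ c : ↥(g '' A), ∃ a : A, g a = (c : M) := by
    rintro ⟨_, a, ha, rfl⟩
    exact ⟨⟨a, ha⟩, rfl⟩
  choose r hr using hr
  refine ⟨φ.relabel (Sum.map r id), fun v => ?_⟩
  refine (hφ _).trans ?_
  rw [Formula.realize_relabel, ← StrongHomClass.realize_formula g (v := Sum.elim _ v ∘ _)]
  refine iff_of_eq (congrArg _ ?_)
  funext z
  rcases z with c | y
  · exact (hr c).symm
  · rfl

theorem DefOver.aut_iff (h : DefOver L A P) (g : M ≃[L] M) (hg : ∀ a ∈ A, g a = a) (v : Y → M) :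
    P (g ∘ v) ↔ P v := by
  obtain ⟨φ, hφ⟩ := h
  rw [hφ, hφ, ← StrongHomClass.realize_formula g (v := Sum.elim _ v)]
  refine iff_of_eq (congrArg _ ?_)
  funext z
  rcases z with c | y
  · exact (hg c c.2).symm
  · rfl

end Definable

/-! ### Enlarging the parameter set of a formula -/

section FormulaOver

variable {L : FirstOrder.Language.{u, v}} {M : Type w} {X : Type w} {A B : Set M}

theorem FormulaOver.mono {φ : L[[M]].Formula X} (h : FormulaOver A φ) (hAB : A ⊆ B) :
    FormulaOver B φ := by
  obtain ⟨ψ, rfl⟩ := h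
  refine ⟨(L.lhomWithConstantsMap (Set.inclusion hAB)).onFormula ψ, ?_⟩
  have h1 : (L.lhomWithConstantsMap ((↑) : B → M)).comp
      (L.lhomWithConstantsMap (Set.inclusion hAB)) = L.lhomWithConstantsMap ((↑) : A → M) := by
    refine LHom.funext ?_ ?_
    · funext n f
      rcases f with f | f
      · rfl
      · rcases n with _ | n
        · rfl
        · exact f.elim
    · funext n f
      rcases f with f | f
      · rfl
      · exact f.elim
  have h2 := LHom.comp_onBoundedFormula (n := 0) (α := X) (L.lhomWithConstantsMap ((↑) : B → M))
      (L.lhomWithConstantsMap (Set.inclusion hAB))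
  rw [h1] at h2
  exact (congrFun h2 ψ).symm

end FormulaOver

/-! ### Consistency, types and indiscernibility in terms of definable predicates -/

section Bridge

variable {L : FirstOrder.Language.{u, v}} {M : Type w} [L.Structure M] {X : Type w}
variable {A B : Set M}

instance isExpansionOn_lhomWithConstantsMap_val :
    (L.lhomWithConstantsMap ((↑) : A → M)).IsExpansionOn M :=
  haveI : (LHom.constantsOnMap ((↑) : A → M)).IsExpansionOn M := constantsOnMap_isExpansionOn rfl
  LHom.sumMap_isExpansionOn _ _ _

theorem FormulaOver.defOver {φ : L[[M]].Formula X} (h : FormulaOver A φ) :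
    DefOver L A φ.Realize := by
  obtain ⟨ψ, rfl⟩ := h
  exact defOver_iff_exists_withConstants.2 ⟨ψ, fun v => LHom.realize_onFormula _ ψ⟩

theorem DefOver.exists_formulaOver {P : (X → M) → Prop} (h : DefOver L A P) :
    ∃ φ : L[[M]].Formula X, FormulaOver A φ ∧ ∀ v, P v ↔ φ.Realize v := by
  obtain ⟨ψ, hψ⟩ := defOver_iff_exists_withConstants.1 h
  exact ⟨_, ⟨ψ, rfl⟩, fun v => (hψ v).trans (LHom.realize_onFormula _ ψ).symm⟩

theorem consistent_union_range_iff {p : Set (L[[M]].Formula X)} {ι : Type*}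
    {ψ : ι → L[[M]].Formula X} :
    Consistent (p ∪ Set.range ψ) ↔ ∀ s : Finset (L[[M]].Formula X), ↑s ⊆ p → ∀ I : Finset ι,
      ∃ c : X → M, (∀ φ ∈ s, φ.Realize c) ∧ ∀ i ∈ I, (ψ i).Realize c := by
  classical
  constructor
  · intro h s hs I
    obtain ⟨c, hc⟩ := h (s ∪ I.image ψ) (by
      intro φ hφ
      rw [Finset.mem_coe, Finset.mem_union, Finset.mem_image] at hφ
      rcases hφ with hφ | ⟨i, -, rfl⟩
      · exact Or.inl (hs hφ)
      · exact Or.inr ⟨i, rfl⟩)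
    exact ⟨c, fun φ hφ => hc φ (Finset.mem_union_left _ hφ), fun i hi =>
      hc _ (Finset.mem_union_right _ (Finset.mem_image_of_mem ψ hi))⟩
  · intro h s hs
    obtain ⟨I, hI⟩ : ∃ I : Finset ι, ∀ φ ∈ s, φ ∉ p → ∃ i ∈ I, ψ i = φ := by
      have : ∀ φ : s, ∃ I : Finset ι, (φ : L[[M]].Formula X) ∉ p → ∃ i ∈ I, ψ i = φ := by
        rintro ⟨φ, hφ⟩
        rcases hs hφ with h' | ⟨i, rfl⟩
        · exact ⟨∅, fun h'' => absurd h' h''⟩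
        · exact ⟨{i}, fun _ => ⟨i, Finset.mem_singleton_self i, rfl⟩⟩
      choose J hJ using this
      refine ⟨Finset.univ.biUnion J, fun φ hφ hn => ?_⟩
      obtain ⟨i, hi, rfl⟩ := hJ ⟨φ, hφ⟩ hn
      exact ⟨i, Finset.mem_biUnion.2 ⟨_, Finset.mem_univ _, hi⟩, rfl⟩
    obtain ⟨c, hc, hc'⟩ := h {φ ∈ s | φ ∈ p} (fun φ hφ => (Finset.mem_filter.1 hφ).2) I
    refine ⟨c, fun φ hφ => ?_⟩
    by_cases hp : φ ∈ p
    · exact hc φ (Finset.mem_filter.2 ⟨hφ, hp⟩)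
    · obtain ⟨i, hi, rfl⟩ := hI φ hφ hp
      exact hc' i hi

theorem consistent_range_iff {ι : Type*} {ψ : ι → L[[M]].Formula X} :
    Consistent (Set.range ψ) ↔ ∀ I : Finset ι, ∃ c : X → M, ∀ i ∈ I, (ψ i).Realize c := by
  rw [← Set.empty_union (Set.range ψ), consistent_union_range_iff]
  constructor
  · intro h I
    obtain ⟨c, -, hc⟩ := h ∅ (by simp) I
    exact ⟨c, hc⟩
  · intro h s hs I
    obtain ⟨c, hc⟩ := h I
    exact ⟨c, fun φ hφ => (hs hφ).elim, hc⟩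

theorem consistent_image_iff {ι : Type*} {ψ : ι → L[[M]].Formula X} {s : Finset ι} :
    Consistent (ψ '' ↑s) ↔ ∃ c : X → M, ∀ i ∈ s, (ψ i).Realize c := by
  classical
  constructor
  · intro h
    obtain ⟨c, hc⟩ := h (s.image ψ) (by simp)
    exact ⟨c, fun i hi => hc _ (Finset.mem_image_of_mem ψ hi)⟩
  · rintro ⟨c, hc⟩ t ht
    refine ⟨c, fun φ hφ => ?_⟩
    obtain ⟨i, hi, rfl⟩ := ht hφ
    exact hc i hi

theorem kInconsistent_inst_iff {k n : ℕ} {φ : L.Formula (X ⊕ Fin n)} {b : ℕ → Fin n → M} :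
    KInconsistent k (fun m => inst φ (b m)) ↔ ∀ s : Finset ℕ, s.card = k →
      ¬ ∃ c : X → M, ∀ m ∈ s, φ.Realize (Sum.elim c (b m)) := by
  simp only [KInconsistent, consistent_image_iff, realize_inst]

theorem sameType_iff {n : ℕ} {a b : Fin n → M} :
    SameType L A a b ↔ ∀ P, DefOver L A P → (P a ↔ P b) := by
  constructor
  · intro h P hP
    obtain ⟨ψ, hψ⟩ := defOver_iff_exists_withConstants.1 hP
    rw [hψ, hψ, h ψ]
  · intro h ψ
    exact h _ (defOver_iff_exists_withConstants.2 ⟨ψ, fun v => Iff.rfl⟩)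

theorem indiscernible_iff {n : ℕ} {a : ℕ → Fin n → M} :
    Indiscernible L A a ↔ ∀ (m : ℕ) (i j : Fin m → ℕ), StrictMono i → StrictMono j →
      ∀ P : (Fin m × Fin n → M) → Prop, DefOver L A P →
        (P (fun z => a (i z.1) z.2) ↔ P (fun z => a (j z.1) z.2)) := by
  constructor
  · intro h m i j hi hj P hP
    obtain ⟨ψ, hψ⟩ := defOver_iff_exists_withConstants.1 hP
    rw [hψ, hψ, h m i j hi hj ψ]
  · intro h m i j hi hj ψ
    exact h m i j hi hj _ (defOver_iff_exists_withConstants.2 ⟨ψ, fun v => Iff.rfl⟩)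

end Bridge

/-! ### Saturation and homogeneity for long tuples -/

section Saturation

variable {L : FirstOrder.Language.{u, v}} {M : Type w} [L.Structure M] {κ : Cardinal.{w}}
variable {A : Set M}

theorem IsMonster.card_union_lt (hM : IsMonster L M κ) {A B : Set M} (hA : #A < κ) (hB : #B < κ) :
    #↥(A ∪ B) < κ :=
  (mk_union_le A B).trans_lt (add_lt_of_lt hM.aleph0_lt.le hA hB)

theorem IsMonster.exists_realize_punit (hM : IsMonster L M κ) (hA : #A < κ) {ι : Type*}
    {P : ι → (PUnit.{w + 1} → M) → Prop} (hP : ∀ i, DefOver L A (P i))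
    (hfin : ∀ I : Finset ι, ∃ v, ∀ i ∈ I, P i v) : ∃ v, ∀ i, P i v := by
  classical
  choose φ hφA hφ using fun i => (hP i).exists_formulaOver
  obtain ⟨c, hc⟩ := hM.saturated A (Set.range φ) hA
    ⟨consistent_range_iff.2 fun I => by simpa only [hφ] using hfin I, by
      rintro _ ⟨i, rfl⟩
      exact hφA i⟩
  exact ⟨c, fun i => (hφ i c).2 (hc _ ⟨i, rfl⟩)⟩

/-- A finitely satisfiable family of definable predicates in fewer than `κ` variables over fewer
than `κ` parameters is realized. -/
theorem IsMonster.exists_realize (hM : IsMonster L M κ) (hA : #A < κ) {Y : Type w} (hY : #Y < κ)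
    {ι : Type*} {P : ι → (Y → M) → Prop} (hP : ∀ i, DefOver L A (P i))
    (hfin : ∀ I : Finset ι, ∃ v, ∀ i ∈ I, P i v) : ∃ v, ∀ i, P i v := by
  classical
  have := hM.nonempty
  let _ : LinearOrder Y := linearOrderOfSTO WellOrderingRel
  have : WellFoundedLT Y := ⟨WellOrderingRel.isWellOrder.wf⟩
  -- The value `d` at `y` keeps the family finitely satisfiable together with the values already
  -- fixed. Only finite sets `T` of these are tested, so that each test is a definable condition on
  -- `d`.
  let good (y : Y) (prev : ∀ z, z < y → M) (d : M) : Prop :=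
    ∀ (I : Finset ι) (T : Finset Y), ∃ v : Y → M, (∀ i ∈ I, P i v) ∧
      (∀ z ∈ T, ∀ h : z < y, v z = prev z h) ∧ v y = d
  let c : Y → M := WellFoundedLT.fix fun y prev => Classical.epsilon (good y prev)
  have hc : ∀ y, c y = Classical.epsilon (good y fun z _ => c z) := fun y =>
    WellFoundedLT.fix_eq (motive := fun _ => M) _ y
  -- Finitely many fixed coordinates lie below the largest of them, so limit stages need no separate
  -- argument.
  have step : ∀ T : Finset Y, (∀ y ∈ T, ∀ (I : Finset ι) (T : Finset Y), ∃ v : Y → M,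
      (∀ i ∈ I, P i v) ∧ ∀ z ∈ T, z ≤ y → v z = c z) →
      ∀ I : Finset ι, ∃ v : Y → M, (∀ i ∈ I, P i v) ∧ ∀ z ∈ T, v z = c z := by
    intro T hT I
    rcases T.eq_empty_or_nonempty with rfl | hne
    · obtain ⟨v, hv⟩ := hfin I
      exact ⟨v, hv, by simp⟩
    · obtain ⟨v, hv, hv'⟩ := hT _ (T.max'_mem hne) I T
      exact ⟨v, hv, fun z hz => hv' z hz (T.le_max' z hz)⟩
  have main : ∀ (y : Y) (I : Finset ι) (T : Finset Y), ∃ v : Y → M,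
      (∀ i ∈ I, P i v) ∧ ∀ z ∈ T, z ≤ y → v z = c z := by
    intro y
    induction y using WellFoundedLT.induction with
    | ind y ih =>
    have hlt : ∀ (I : Finset ι) (T : Finset Y), ∃ v : Y → M,
        (∀ i ∈ I, P i v) ∧ ∀ z ∈ T, z < y → v z = c z := by
      intro I T
      obtain ⟨v, hv, hv'⟩ := step {z ∈ T | z < y}
        (fun z hz => ih z (Finset.mem_filter.1 hz).2) I
      exact ⟨v, hv, fun z hz hzy => hv' z (Finset.mem_filter.2 ⟨hz, hzy⟩)⟩
    have hB : #↥(A ∪ Set.range c) < κ :=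
      hM.card_union_lt hA (mk_range_le.trans_lt hY)
    -- Saturation in one variable applies once all coordinates of `v` are quantified away.
    obtain ⟨d, hd⟩ := hM.exists_realize_punit hB (ι := Finset ι × Finset Y)
      (P := fun J d => ∃ v : Y → M, (∀ i ∈ J.1, P i v) ∧
        (∀ z ∈ J.2.filter (· < y), v z = c z) ∧ v y = d ⟨⟩) (by
        rintro ⟨I, T⟩
        refine DefOver.exists (P := fun v : PUnit ⊕ Y → M => (∀ i ∈ I, P i (v ∘ Sum.inr)) ∧
          (∀ z ∈ T.filter (· < y), v (Sum.inr z) = c z) ∧ v (Sum.inr y) = v (Sum.inl ⟨⟩))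
          (DefOver.and ?_ (DefOver.and ?_ ?_))
        · exact DefOver.ball I fun i _ => ((hP i).mono Set.subset_union_left).comp Sum.inr
        · exact DefOver.ball _ fun z _ => defOver_eq_const _ (Or.inr ⟨z, rfl⟩)
        · exact defOver_eq _ _) (by
        intro K
        obtain ⟨v, hv, hv'⟩ := hlt (K.biUnion Prod.fst) (K.biUnion Prod.snd)
        refine ⟨fun _ => v y, fun J hJ => ⟨v, fun i hi => hv i ?_, fun z hz => ?_, rfl⟩⟩
        · exact Finset.mem_biUnion.2 ⟨J, hJ, hi⟩
        · rw [Finset.mem_filter] at hz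
          exact hv' z (Finset.mem_biUnion.2 ⟨J, hJ, hz.1⟩) hz.2)
    have hgood : good y (fun z _ => c z) (c y) := by
      rw [hc y]
      refine Classical.epsilon_spec (p := good y fun z _ => c z) ⟨d ⟨⟩, fun I T => ?_⟩
      obtain ⟨v, hv, hv', hy⟩ := hd (I, T)
      exact ⟨v, hv, fun z hz h => hv' z (Finset.mem_filter.2 ⟨hz, h⟩), hy⟩
    intro I T
    obtain ⟨v, hv, hv', hy⟩ := hgood I T
    refine ⟨v, hv, fun z hz hzy => ?_⟩
    rcases hzy.eq_or_lt with rfl | h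
    · exact hy
    · exact hv' z hz h
  refine ⟨c, fun i => ?_⟩
  obtain ⟨T, hT⟩ := (hP i).exists_finset
  obtain ⟨v, hv, hv'⟩ := step T (fun y _ => main y) {i}
  exact (hT v c hv').1 (hv i (Finset.mem_singleton_self i))

/-- Tuples of length less than `κ` with the same type over fewer than `κ` parameters are
conjugate. -/
theorem IsMonster.exists_aut (hM : IsMonster L M κ) (hA : #A < κ) {Y : Type w} (hY : #Y < κ)
    {a b : Y → M} (hab : ∀ P, DefOver L A P → (P a ↔ P b)) :
    ∃ g : M ≃[L] M, (∀ c ∈ A, g c = c) ∧ ∀ y, g (a y) = b y := by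
  classical
  have hr : ∀ s : ↥(A ∪ Set.range a), ∃ r : A ⊕ Y, Sum.elim (↑) a r = (s : M) := by
    rintro ⟨c, hc | ⟨y, rfl⟩⟩
    · exact ⟨Sum.inl ⟨c, hc⟩, rfl⟩
    · exact ⟨Sum.inr y, rfl⟩
  choose r hr using hr
  obtain ⟨g, hg⟩ := hM.homogeneous (A ∪ Set.range a) (fun s => Sum.elim (↑) b (r s))
    (hM.card_union_lt hA (mk_range_le.trans_lt hY)) (by
      intro φ
      have h := hab _ ⟨φ.relabel r, fun v => Iff.rfl⟩
      rw [Formula.realize_relabel, Formula.realize_relabel] at h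
      refine Iff.trans (iff_of_eq (congrArg _ ?_)) h
      funext s
      exact (hr s).symm)
  have key : ∀ (x : A ⊕ Y), g (Sum.elim (↑) a x) = Sum.elim (↑) b x := by
    intro x
    have hx : Sum.elim (↑) a x ∈ A ∪ Set.range a := by
      rcases x with x | x
      · exact Or.inl x.2
      · exact Or.inr ⟨x, rfl⟩
    refine (hg ⟨_, hx⟩).trans ?_
    -- An element may have several names, as a parameter or as a coordinate of `a`. Equality of two
    -- names belongs to the type of `a`, so it also holds for `b`.
    have h := hab (fun v => Sum.elim (↑) v (r ⟨_, hx⟩) = Sum.elim (↑) v x)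
      ⟨Term.equal (Term.var (r ⟨_, hx⟩)) (Term.var x), fun v => by
        simp [Formula.realize_equal]⟩
    exact h.1 (hr ⟨_, hx⟩)
  exact ⟨g, fun c hc => key (Sum.inl ⟨c, hc⟩), fun y => key (Sum.inr y)⟩

/-- A tuple all of whose finite subtuples are conjugate to those of another one is conjugate to
it. -/
theorem IsMonster.exists_aut_of_finset (hM : IsMonster L M κ) (hA : #A < κ) {Y : Type w}
    (hY : #Y < κ) {a b : Y → M}
    (hab : ∀ T : Finset Y, ∃ g : M ≃[L] M, (∀ c ∈ A, g c = c) ∧ ∀ y ∈ T, g (a y) = b y) :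
    ∃ g : M ≃[L] M, (∀ c ∈ A, g c = c) ∧ ∀ y, g (a y) = b y := by
  refine hM.exists_aut hA hY fun P hP => ?_
  obtain ⟨T, hT⟩ := hP.exists_finset
  obtain ⟨g, hgA, hg⟩ := hab T
  rw [← hT (g ∘ a) b hg, hP.aut_iff g hgA]

end Saturation

/-! ### Dividing and indiscernible sequences -/

section Dividing

variable {L : FirstOrder.Language.{u, v}} {M : Type w} [L.Structure M] {X : Type w}
variable {κ : Cardinal.{w}} {A B : Set M} {n k : ℕ} {φ : L.Formula (X ⊕ Fin n)}

/-- The instances of `φ(x, y)` at the rows of the matrix `v` are jointly consistent. -/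
def JointlyRealized (φ : L.Formula (X ⊕ Fin n)) (v : Fin k × Fin n → M) : Prop :=
  ∃ x : X → M, ∀ l : Fin k, φ.Realize (Sum.elim x fun t => v (l, t))

/-- Puts `k`-inconsistency of a row into its type, so that it can be transferred by
indiscernibility, compactness and averages. -/
theorem defOver_jointlyRealized [Nonempty M] (φ : L.Formula (X ⊕ Fin n)) :
    DefOver L A (JointlyRealized (M := M) (k := k) φ) := by
  refine DefOver.exists (P := fun v : (Fin k × Fin n) ⊕ X → M =>
    ∀ l : Fin k, φ.Realize (Sum.elim (v ∘ Sum.inr) fun t => v (Sum.inl (l, t)))) ?_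
  refine (DefOver.ball (R := fun (l : Fin k) (v : (Fin k × Fin n) ⊕ X → M) =>
    φ.Realize (Sum.elim (v ∘ Sum.inr) fun t => v (Sum.inl (l, t)))) Finset.univ
    (fun l _ => ?_)).congr fun v => by simp
  refine ⟨φ.relabel (Sum.elim (fun x => Sum.inr (Sum.inr x))
    fun t => Sum.inr (Sum.inl (l, t))), fun v => ?_⟩
  rw [Formula.realize_relabel]
  refine iff_of_eq (congrArg _ ?_)
  funext z
  rcases z with z | z <;> rfl

theorem KInconsistent.not_jointlyRealized {b : ℕ → Fin n → M}
    (h : KInconsistent k fun m => inst φ (b m)) {i : Fin k → ℕ} (hi : Function.Injective i) :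
    ¬ JointlyRealized φ fun z : Fin k × Fin n => b (i z.1) z.2 := by
  rintro ⟨x, hx⟩
  refine kInconsistent_inst_iff.1 h (Finset.univ.map ⟨i, hi⟩) (by simp) ⟨x, fun m hm => ?_⟩
  obtain ⟨l, -, rfl⟩ := Finset.mem_map.1 hm
  exact hx l

theorem kInconsistent_of_not_jointlyRealized {b : ℕ → Fin n → M}
    (h : ∀ i : Fin k → ℕ, StrictMono i →
      ¬ JointlyRealized φ fun z : Fin k × Fin n => b (i z.1) z.2) :
    KInconsistent k fun m => inst φ (b m) := by
  refine kInconsistent_inst_iff.2 fun s hs => ?_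
  rintro ⟨x, hx⟩
  exact h (s.orderEmbOfFin hs) (s.orderEmbOfFin hs).strictMono
    ⟨x, fun l => hx _ (s.orderEmbOfFin_mem hs l)⟩

theorem KInconsistent.not_consistent_range {ψ : ℕ → L[[M]].Formula X}
    (h : KInconsistent k ψ) : ¬ Consistent (Set.range ψ) := by
  intro hc
  refine h (Finset.range k) (Finset.card_range k) fun s hs => hc s (hs.trans ?_)
  exact Set.image_subset_range _ _

theorem FormulaDivides.mono {a : Fin n → M} (h : FormulaDivides B φ a) (hAB : A ⊆ B) :
    FormulaDivides A φ a := by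
  obtain ⟨k, b, hb, hk⟩ := h
  exact ⟨k, b, fun i => sameType_iff.2 fun P hP => sameType_iff.1 (hb i) P (hP.mono hAB), hk⟩

/-- An indiscernible sequence along which `φ(x, y)` is inconsistent witnesses dividing. -/
theorem Indiscernible.formulaDivides [Nonempty M] {a : ℕ → Fin n → M} (h : Indiscernible L A a)
    (hinc : ¬ Consistent (Set.range fun m => inst φ (a m))) (m : ℕ) :
    FormulaDivides A φ (a m) := by
  rw [indiscernible_iff] at h
  rw [consistent_range_iff] at hinc
  push Not at hinc
  obtain ⟨T, hT⟩ := hinc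
  -- Some finite subfamily, indexed by `T`, is inconsistent; by indiscernibility so is every
  -- subfamily of the same size.
  refine ⟨T.card, a, fun i => sameType_iff.2 fun P hP => ?_, ?_⟩
  · exact h 1 (fun _ => i) (fun _ => m) (Subsingleton.strictMono _) (Subsingleton.strictMono _) _
      (hP.comp fun t => ((0 : Fin 1), t))
  · refine kInconsistent_of_not_jointlyRealized fun i hi hc => ?_
    have hc' := (h T.card i (T.orderEmbOfFin rfl) hi (T.orderEmbOfFin rfl).strictMono _
      (defOver_jointlyRealized φ)).1 hc
    obtain ⟨x, hx⟩ := hc'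
    obtain ⟨m, hm, hm'⟩ := hT x
    refine hm' ((realize_inst _ _ _).2 ?_)
    obtain ⟨l, rfl⟩ : m ∈ Set.range (T.orderEmbOfFin rfl) := by
      rwa [Finset.range_orderEmbOfFin]
    exact hx l

theorem IsMonster.card_range_lt_of_countable (hM : IsMonster L M κ) {ι : Type*} [Countable ι]
    (f : ι → M) : #(Set.range f) < κ :=
  (Set.countable_range f).le_aleph0.trans_lt hM.aleph0_lt

theorem IsMonster.card_ulift_lt_of_countable (hM : IsMonster L M κ) {ι : Type} [Countable ι] :
    #(ULift.{w} ι) < κ :=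
  mk_le_aleph0.trans_lt hM.aleph0_lt

/-- The average type of a sequence along an ultrafilter is realized over small sets. -/
theorem IsMonster.exists_realize_average (hM : IsMonster L M κ) (hA : #A < κ)
    (U : Filter ℕ) [U.NeBot] (b : ℕ → Fin n → M) :
    ∃ d : Fin n → M, ∀ P, DefOver L A P → (∀ᶠ i in U, P (b i)) → P d := by
  obtain ⟨v, hv⟩ := hM.exists_realize hA (hM.card_ulift_lt_of_countable (ι := Fin n))
    (ι := {P : (Fin n → M) → Prop // DefOver L A P ∧ ∀ᶠ i in U, P (b i)})
    (P := fun P v => P.1 (v ∘ ULift.up)) (fun P => P.2.1.comp ULift.up) (by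
      intro I
      have h : ∀ᶠ i in U, ∀ P ∈ I, P.1 (b i) :=
        (Filter.eventually_all_finset I).2 fun P _ => P.2.2
      obtain ⟨i, hi⟩ := h.exists
      exact ⟨fun t => b i t.down, fun P hP => hi P hP⟩)
  exact ⟨v ∘ ULift.up, fun P hP hU => hv ⟨P, hP, hU⟩⟩

/-- Dividing is witnessed by indiscernible sequences. -/
theorem IsMonster.exists_indiscernible (hM : IsMonster L M κ) (hA : #A < κ) {a : Fin n → M}
    {b : ℕ → Fin n → M} (hb : ∀ i, SameType L A (b i) a)
    (hk : KInconsistent k fun m => inst φ (b m)) :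
    ∃ c : ℕ → Fin n → M, Indiscernible L A c ∧ (∀ i, SameType L A (c i) a) ∧
      KInconsistent k fun m => inst φ (c m) := by
  classical
  have := hM.nonempty
  -- A Morley sequence replaces Ramsey's theorem: `c m` realizes the average type of `b` along a
  -- nonprincipal ultrafilter over `A'` and the earlier `c j`. The entries of `b` are put into `A'`
  -- so that they may be substituted into predicates as parameters.
  let U := Filter.hyperfilter ℕ
  let A' : Set M := A ∪ Set.range fun z : ℕ × Fin n => b z.1 z.2
  have hA' : #A' < κ := hM.card_union_lt hA (hM.card_range_lt_of_countable _)
  have hAA' : A ⊆ A' := Set.subset_union_left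
  have hbA' : ∀ i t, b i t ∈ A' := fun i t => Or.inr ⟨(i, t), rfl⟩
  let base (m : ℕ) (prev : ∀ j, j < m → Fin n → M) : Set M :=
    A' ∪ Set.range fun z : Fin m × Fin n => prev z.1 z.1.2 z.2
  let c : ℕ → Fin n → M := WellFoundedLT.fix fun m prev => Classical.epsilon fun d =>
    ∀ P, DefOver L (base m prev) P → (∀ᶠ i in U, P (b i)) → P d
  have hc₀ : ∀ m P, DefOver L (base m fun j _ => c j) P → (∀ᶠ i in U, P (b i)) → P (c m) := by
    intro m
    have hcm : c m = Classical.epsilon fun d =>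
        ∀ P, DefOver L (base m fun j _ => c j) P → (∀ᶠ i in U, P (b i)) → P d :=
      WellFoundedLT.fix_eq (motive := fun _ => Fin n → M) _ m
    rw [hcm]
    exact Classical.epsilon_spec (hM.exists_realize_average
      (hM.card_union_lt hA' (hM.card_range_lt_of_countable _)) U b)
  have hc : ∀ m P, DefOver L (base m fun j _ => c j) P → (P (c m) ↔ ∀ᶠ i in U, P (b i)) := by
    refine fun m P hP => ⟨fun h => ?_, hc₀ m P hP⟩
    by_contra hU
    exact hc₀ m _ hP.not (Ultrafilter.eventually_not.2 hU) h
  let slice (m : ℕ) (P : (Fin (m + 1) × Fin n → M) → Prop) (d : Fin n → M)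
      (v : Fin m × Fin n → M) : Prop :=
    P fun z => Fin.lastCases (motive := fun _ => M) (d z.2) (fun l => v (l, z.2)) z.1
  have hslice : ∀ m (P : (Fin (m + 1) × Fin n → M) → Prop), DefOver L A' P → ∀ i,
      DefOver L A' (slice m P (b i)) := by
    intro m P hP i
    refine (hP.subst (fun z => Fin.lastCases (motive := fun _ => A' ⊕ (Fin m × Fin n))
      (Sum.inl ⟨b i z.2, hbA' i z.2⟩) (fun l => Sum.inr (l, z.2)) z.1) subset_rfl).congr
      fun v => iff_of_eq (congrArg P ?_)
    funext ⟨l, t⟩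
    refine Fin.lastCases ?_ (fun l => ?_) l <;> simp
  -- The last tuple can be traded for `b t`, for `U`-most `t`. The index of that tuple disappears,
  -- so indiscernibility follows by induction on the number of tuples.
  have hsnoc : ∀ m (P : (Fin (m + 1) × Fin n → M) → Prop), DefOver L A' P →
      ∀ i : Fin (m + 1) → ℕ, StrictMono i → ((P fun z => c (i z.1) z.2) ↔
        ∀ᶠ t in U, slice m P (b t) fun z => c (i z.1.castSucc) z.2) := by
    intro m P hP i hi
    rw [← hc (i (Fin.last m)) (fun d => slice m P d fun z => c (i z.1.castSucc) z.2)]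
    · refine iff_of_eq (congrArg P ?_)
      funext ⟨l, t⟩
      refine Fin.lastCases ?_ (fun l => ?_) l <;> simp
    · refine (hP.subst (B := base _ fun j _ => c j)
        (fun z => Fin.lastCases (motive := fun _ => _ ⊕ Fin n) (Sum.inr z.2)
        (fun l => Sum.inl ⟨c (i l.castSucc) z.2, Or.inr
          ⟨(⟨i l.castSucc, hi (Fin.castSucc_lt_last l)⟩, z.2), rfl⟩⟩) z.1)
        Set.subset_union_left).congr fun v => iff_of_eq (congrArg P ?_)
      funext ⟨l, t⟩
      refine Fin.lastCases ?_ (fun l => ?_) l <;> simp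
  have hmono : ∀ {m : ℕ} {i : Fin (m + 1) → ℕ}, StrictMono i →
      StrictMono fun l : Fin m => i l.castSucc :=
    fun hi => hi.comp (Fin.strictMono_castSucc)
  refine ⟨c, indiscernible_iff.2 fun m i j hi hj P hP => ?_, fun i => ?_, ?_⟩
  · replace hP := hP.mono hAA'
    clear_value A'
    induction m with
    | zero =>
      refine iff_of_eq (congrArg P ?_)
      funext z
      exact z.1.elim0
    | succ m ih =>
      rw [hsnoc m P hP i hi, hsnoc m P hP j hj]
      exact Filter.eventually_congr (Filter.Eventually.of_forall fun t =>
        ih _ _ (hmono hi) (hmono hj) _ (hslice m P hP t))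
  · refine sameType_iff.2 fun P hP => ?_
    rw [hc i P (hP.mono (hAA'.trans Set.subset_union_left))]
    simp only [sameType_iff.1 (hb _) P hP, Filter.eventually_const]
  -- Trading the tuples from last to first pulls any property of the `c`'s back to the `b`'s. As `U`
  -- is nonprincipal, each new index can avoid the finite set `T` of those already used, so the
  -- indices are distinct.
  · have extract : ∀ (m : ℕ) (P : (Fin m × Fin n → M) → Prop), DefOver L A' P →
        ∀ i : Fin m → ℕ, StrictMono i → (P fun z => c (i z.1) z.2) → ∀ T : Finset ℕ,
          ∃ t : Fin m → ℕ, Function.Injective t ∧ (∀ l, t l ∉ T) ∧ P fun z => b (t z.1) z.2 := by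
      intro m
      induction m with
      | zero =>
        intro P _ i _ h T
        refine ⟨Fin.elim0, fun l => l.elim0, fun l => l.elim0, ?_⟩
        convert h using 1
        funext z
        exact z.1.elim0
      | succ m ih =>
        intro P hP i hi h T
        rw [hsnoc m P hP i hi] at h
        have hT : ∀ᶠ t in (U : Filter ℕ), t ∉ T := by
          have : ∀ᶠ t in Filter.cofinite, t ∉ T := T.finite_toSet.compl_mem_cofinite
          exact this.filter_mono Filter.hyperfilter_le_cofinite
        obtain ⟨t₀, ht₀, ht₀T⟩ := (h.and hT).exists
        obtain ⟨t, htinj, htT, ht⟩ := ih _ (hslice m P hP t₀) _ (hmono hi) ht₀ (insert t₀ T)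
        refine ⟨Fin.snoc t t₀, ?_, ?_, ?_⟩
        · rw [Fin.snoc_injective_iff]
          refine ⟨htinj, ?_⟩
          rintro ⟨l, rfl⟩
          exact htT l (Finset.mem_insert_self _ _)
        · intro l
          refine Fin.lastCases ?_ (fun l => ?_) l
          · simpa using ht₀T
          · simpa using fun h => htT l (Finset.mem_insert_of_mem h)
        · convert ht using 1
          funext ⟨l, s⟩
          refine Fin.lastCases ?_ (fun l => ?_) l <;> simp
    refine kInconsistent_of_not_jointlyRealized fun i hi h => ?_
    obtain ⟨t, ht, -, h'⟩ := extract k _ (defOver_jointlyRealized φ) i hi h ∅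
    exact hk.not_jointlyRealized ht h'

theorem IsMonster.exists_aut_fin (hM : IsMonster L M κ) (hA : #A < κ) {a b : Fin n → M}
    (hab : SameType L A a b) :
    ∃ g : M ≃[L] M, (∀ c ∈ A, g c = c) ∧ ∀ t, g (a t) = b t := by
  obtain ⟨g, hgA, hg⟩ := hM.exists_aut hA (hM.card_ulift_lt_of_countable (ι := Fin n))
    (a := a ∘ ULift.down) (b := b ∘ ULift.down) fun P hP =>
      sameType_iff.1 hab _ (hP.comp ULift.down)
  exact ⟨g, hgA, fun t => hg ⟨t⟩⟩

theorem realize_aut_iff (φ : L.Formula (X ⊕ Fin n)) (g : M ≃[L] M) (x : X → M) (a : Fin n → M) :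
    φ.Realize (Sum.elim (g ∘ x) (g ∘ a)) ↔ φ.Realize (Sum.elim x a) := by
  rw [← StrongHomClass.realize_formula g (v := Sum.elim x a), Sum.comp_elim]

theorem KInconsistent.aut {b : ℕ → Fin n → M} (h : KInconsistent k fun m => inst φ (b m))
    (g : M ≃[L] M) : KInconsistent k fun m => inst φ (g ∘ b m) := by
  rw [kInconsistent_inst_iff] at h ⊢
  rintro s hs ⟨x, hx⟩
  refine h s hs ⟨g.symm ∘ x, fun m hm => ?_⟩
  rw [← realize_aut_iff φ g]
  convert hx m hm using 2
  funext y
  simp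

theorem Indiscernible.aut {b : ℕ → Fin n → M} (h : Indiscernible L A b) (g : M ≃[L] M) :
    Indiscernible L (g '' A) fun m => g ∘ b m := by
  rw [indiscernible_iff] at h ⊢
  intro m i j hi hj P hP
  exact h m i j hi hj _ hP.of_image

theorem Indiscernible.mono {b : ℕ → Fin n → M} (h : Indiscernible L B b) (hAB : A ⊆ B) :
    Indiscernible L A b := by
  rw [indiscernible_iff] at h ⊢
  exact fun m i j hi hj P hP => h m i j hi hj P (hP.mono hAB)

/-- A type over `B` that divides over `A` implies a formula over `B` that divides over `A`. -/
theorem IsMonster.exists_formulaDivides (hM : IsMonster L M κ) (hA : #A < κ)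
    {q : Set (L[[M]].Formula X)} (hq : ∀ φ ∈ q, FormulaOver B φ) (h : TypeDivides A q) :
    ∃ (m : ℕ) (θ : L.Formula (X ⊕ Fin m)) (b : Fin m → M),
      (∀ t, b t ∈ B) ∧ Implies q (inst θ b) ∧ FormulaDivides A θ b := by
  obtain ⟨n, φ, a, ⟨s, hs, himp⟩, k, a', ha', hk⟩ := h
  -- The parameters `a` of the dividing formula may lie outside `B`; the conjunction `θ(x, b)` of
  -- the finitely many formulas implying it has parameters in `B`.
  obtain ⟨m, θ, b, hb, hθ⟩ := (DefOver.ball (R := fun φ : L[[M]].Formula X => φ.Realize) s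
    fun φ hφ => (hq φ (hs hφ)).defOver).exists_fin
  refine ⟨m, θ, b, hb, ⟨s, hs, fun c hc => (realize_inst _ _ _).2 ((hθ c).1 hc)⟩, ?_⟩
  have hθφ : ∀ x, θ.Realize (Sum.elim x b) → φ.Realize (Sum.elim x a) := fun x hx =>
    (realize_inst _ _ _).1 (himp x ((hθ x).2 hx))
  -- Since `g i` moves `a` to `a' i`, the formula `θ(x, g i b)` implies `φ(x, a' i)` and inherits
  -- `k`-inconsistency.
  choose g hgA hg using fun i => hM.exists_aut_fin hA
    (sameType_iff.2 fun P hP => (sameType_iff.1 (ha' i) P hP).symm)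
  refine ⟨k, fun i => g i ∘ b, fun i => sameType_iff.2 fun P hP => hP.aut_iff (g i) (hgA i) b, ?_⟩
  rw [kInconsistent_inst_iff] at hk ⊢
  rintro S hS ⟨x, hx⟩
  refine hk S hS ⟨x, fun i hi => ?_⟩
  have hgx : g i ∘ ((g i).symm ∘ x) = x := by
    funext y
    simp
  have h1 := hx i hi
  rw [← hgx, realize_aut_iff] at h1
  have h2 := (realize_aut_iff φ (g i) _ _).2 (hθφ _ h1)
  rw [hgx] at h2
  convert h2 using 2
  funext t
  exact (hg i t).symm

end Dividing

/-! ### Trees, dividing sequences and dividing chains -/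

section Equivalences

variable {L : FirstOrder.Language.{u, v}} {M : Type w} [L.Structure M] {X : Type w}
variable {κ : Cardinal.{w}} {A : Set M} {p : Set (L[[M]].Formula X)} {α : Ordinal.{w}}

theorem IsMonster.card_sigma_lt (hM : IsMonster L M κ) {ι : Type w} (hι : #ι < κ)
    (τ : ι → Type) [∀ i, Countable (τ i)] : #(Σ i, τ i) < κ := by
  rw [mk_sigma]
  refine (sum_le_sum _ (fun _ => ℵ₀) fun i => mk_le_aleph0).trans_lt ?_
  rw [sum_const]
  exact mul_lt_of_lt hM.aleph0_lt.le (by simpa using hι) (by simpa using hM.aleph0_lt)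

theorem IsMonster.card_union_iUnion_range_lt (hM : IsMonster L M κ) (hA : #A < κ) {ι : Type w}
    (hι : #ι < κ) {n : ι → ℕ} (a : ∀ i, Fin (n i) → M) :
    #↥(A ∪ ⋃ i, Set.range (a i)) < κ := by
  refine hM.card_union_lt hA ?_
  have h : (⋃ i, Set.range (a i)) = Set.range fun z : Σ i, Fin (n i) => a z.1 z.2 := by
    rw [Set.range_sigma_eq_iUnion_range]
  rw [h]
  exact mk_range_le.trans_lt (hM.card_sigma_lt hι _)

theorem card_subtype_toType_lt (hα : α.card < κ) (S : Set α.ToType) : #S < κ :=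
  (mk_set_le S).trans_lt (by rwa [mk_toType])

/-- A dividing sequence generates a tree all of whose branches are conjugate to it. -/
theorem IsMonster.exists_tree (hM : IsMonster L M κ) (hA : #A < κ) (hp : IsPartialType A p)
    (hα : α.card < κ) (h : DividingSequence A p α) :
    ∃ (n : α.ToType → ℕ)
      (b : (i : α.ToType) → (Set.Iio i → ℕ) → ℕ → Fin (n i) → M)
      (φ : (i : α.ToType) → L.Formula (X ⊕ Fin (n i))) (k : α.ToType → ℕ),
      (∀ i s, Indiscernible L (A ∪ earlier (n := fun i _ => n i) b s) (b i s)) ∧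
      (∀ i s, KInconsistent (k i) fun m => inst (φ i) (b i s m)) ∧
      ∀ f : α.ToType → ℕ,
        Consistent (p ∪ Set.range fun i => inst (φ i) (b i (cut f i) (f i))) := by
  classical
  obtain ⟨n, φ, a, hcons, hdiv⟩ := h
  have hC : ∀ i : α.ToType, #↥(A ∪ ⋃ j : Set.Iio i, Set.range (a j)) < κ := fun i =>
    hM.card_union_iUnion_range_lt hA (card_subtype_toType_lt hα _) fun j : Set.Iio i => a j
  choose k b₀ hb₀ hk₀ using hdiv
  choose c hcind hctp hck using fun i => hM.exists_indiscernible (hC i) (hb₀ i) (hk₀ i)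
  -- `h i m` fixes `A` and all `a j` with `j < i`, and moves `a i` to `c i m`.
  choose h hhC hh using fun i m => hM.exists_aut_fin (hC i)
    (sameType_iff.2 fun P hP => (sameType_iff.1 (hctp i m) P hP).symm)
  have hhA : ∀ i m, ∀ x ∈ A, h i m x = x := fun i m x hx => hhC i m x (Or.inl hx)
  have hha : ∀ i m, ∀ j < i, ∀ t, h i m (a j t) = a j t := fun i m j hj t =>
    hhC i m _ (Or.inr (Set.mem_iUnion.2 ⟨⟨j, hj⟩, t, rfl⟩))
  have : Nonempty (M ≃[L] M) := ⟨Language.Equiv.refl L M⟩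
  let ok (i : α.ToType) (prev : ∀ j, j < i → (Set.Iio j → ℕ) → ℕ → Fin (n j) → M)
      (s : Set.Iio i → ℕ) (g : M ≃[L] M) : Prop :=
    (∀ x ∈ A, g x = x) ∧
      ∀ (j : Set.Iio i) (t), g (a j t) = prev j j.2 (restr s j) (s j) t
  -- The automorphism is chosen from the node alone, not from `m`, so the whole row is the image of
  -- `c i` under a single map. That such a choice exists is proved afterwards, in `hg`.
  let b : (i : α.ToType) → (Set.Iio i → ℕ) → ℕ → Fin (n i) → M :=
    WellFoundedLT.fix fun i prev s m t => Classical.epsilon (ok i prev s) (c i m t)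
  let g (i : α.ToType) (s : Set.Iio i → ℕ) : M ≃[L] M :=
    Classical.epsilon (ok i (fun j _ => b j) s)
  have hb : ∀ i s m t, b i s m t = g i s (c i m t) := fun i s m t =>
    congrFun (congrFun (congrFun (WellFoundedLT.fix_eq
      (motive := fun i => (Set.Iio i → ℕ) → ℕ → Fin (n i) → M) _ i) s) m) t
  -- Conjugacy extends by one level: `h i m` first moves `a i` into place `m` of the row `c i`
  -- without disturbing earlier levels, then `g i s` is applied.
  have conj : ∀ i s, ok i (fun j _ => b j) s (g i s) → ∀ m, ∃ g' : M ≃[L] M,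
      (∀ x ∈ A, g' x = x) ∧ (∀ (j : Set.Iio i) t, g' (a j t) = b j (restr s j) (s j) t) ∧
        ∀ t, g' (a i t) = b i s m t := by
    intro i s hg m
    refine ⟨(g i s).comp (h i m), fun x hx => ?_, fun j t => ?_, fun t => ?_⟩
    · rw [Language.Equiv.comp_apply, hhA i m x hx, hg.1 x hx]
    · rw [Language.Equiv.comp_apply, hha i m j j.2, hg.2 j t]
    · rw [Language.Equiv.comp_apply, hh, hb]
  have hg : ∀ i s, ok i (fun j _ => b j) s (g i s) := by
    intro i
    induction i using WellFoundedLT.induction with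
    | ind i ih =>
    intro s
    refine Classical.epsilon_spec (p := ok i (fun j _ => b j) s) ?_
    obtain ⟨g', hg'A, hg'⟩ := hM.exists_aut_of_finset hA (Y := Σ j : Set.Iio i, Fin (n j))
      (hM.card_sigma_lt (card_subtype_toType_lt hα _) _) (a := fun z => a z.1 z.2)
      (b := fun z => b z.1 (restr s z.1) (s z.1) z.2) (by
        intro T
        rcases T.eq_empty_or_nonempty with rfl | hne
        · exact ⟨Language.Equiv.refl L M, fun x _ => rfl, by simp⟩
        -- Finitely many parameters reach only up to a top level `j₀ < i`, where the inductive
        -- hypothesis and `conj` supply the automorphism.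
        · obtain ⟨j₀, hj₀⟩ : ∃ j₀ : Set.Iio i, ∀ z ∈ T, z.1 ≤ j₀ :=
            ⟨(T.image Sigma.fst).max' (hne.image _), fun z hz =>
              Finset.le_max' _ _ (Finset.mem_image_of_mem _ hz)⟩
          obtain ⟨g', hg'A, hg'lt, hg'⟩ := conj j₀ _ (ih j₀ j₀.2 (restr s j₀)) (s j₀)
          refine ⟨g', hg'A, ?_⟩
          rintro ⟨j, t⟩ hz
          rcases (hj₀ _ hz).eq_or_lt with hj | hj
          · obtain rfl : j = j₀ := hj
            exact hg' t
          · exact hg'lt ⟨j, hj⟩ t)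
    exact ⟨g', hg'A, fun j t => hg' ⟨j, t⟩⟩
  have hrow : ∀ i s, b i s = fun m => g i s ∘ c i m := fun i s => by
    funext m t
    exact hb i s m t
  refine ⟨n, b, φ, k, fun i s => ?_, fun i s => ?_, fun f => ?_⟩
  · rw [hrow i s]
    refine ((hcind i).aut (g i s)).mono ?_
    rintro x (hx | hx)
    · exact ⟨x, Or.inl hx, (hg i s).1 x hx⟩
    · obtain ⟨j, t, rfl⟩ := Set.mem_iUnion.1 hx
      exact ⟨a j t, Or.inr (Set.mem_iUnion.2 ⟨j, t, rfl⟩), (hg i s).2 j t⟩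
  · rw [hrow i s]
    exact (hck i).aut (g i s)
  · rw [consistent_union_range_iff] at hcons ⊢
    intro s hs I
    obtain ⟨x, hx, hxI⟩ := hcons s hs I
    obtain ⟨g', hg'A, hg'⟩ : ∃ g' : M ≃[L] M, (∀ x ∈ A, g' x = x) ∧
        ∀ i ∈ I, ∀ t, g' (a i t) = b i (cut f i) (f i) t := by
      rcases I.eq_empty_or_nonempty with rfl | hne
      · exact ⟨Language.Equiv.refl L M, fun x _ => rfl, by simp⟩
      · obtain ⟨g', hg'A, hg'lt, hg'⟩ :=
          conj (I.max' hne) _ (hg _ (cut f (I.max' hne))) (f (I.max' hne))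
        refine ⟨g', hg'A, fun i hi t => ?_⟩
        rcases (I.le_max' i hi).eq_or_lt with h | h
        · rw [← h] at hg'
          exact hg' t
        · exact hg'lt ⟨i, h⟩ t
    refine ⟨g' ∘ x, fun ψ hψ => ?_, fun i hi => ?_⟩
    · exact ((hp.2 ψ (hs hψ)).defOver.aut_iff g' hg'A x).2 (hx ψ hψ)
    · have h1 := (realize_aut_iff (φ i) g' x (a i)).2 ((realize_inst _ _ _).1 (hxI i hi))
      rw [realize_inst]
      convert h1 using 2
      funext t
      exact (hg' i hi t).symm

theorem IsMonster.plusLeDD_of_dividingSequence (hM : IsMonster L M κ) (hA : #A < κ)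
    (hp : IsPartialType A p) (hα : α.card < κ) (h : DividingSequence A p α) : PlusLeDD p α := by
  obtain ⟨n, b, φ, k, -, hk, hc⟩ := hM.exists_tree hA hp hα h
  exact ⟨n, b, φ, k, hk, hc⟩

theorem IsMonster.indiscernibleTree_of_dividingSequence (hM : IsMonster L M κ) (hA : #A < κ)
    (hp : IsPartialType A p) (hα : α.card < κ) (h : DividingSequence A p α) :
    IndiscernibleTree A p α := by
  obtain ⟨n, b, φ, k, hind, hk, hc⟩ := hM.exists_tree hA hp hα h
  exact ⟨n, b, φ, hind, fun i s => (hk i s).not_consistent_range, hc⟩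

theorem IndiscernibleTree.indiscernibleFormulaTree (h : IndiscernibleTree A p α) :
    IndiscernibleFormulaTree A p α := by
  obtain ⟨n, a, φ, hind, hinc, hc⟩ := h
  exact ⟨fun i _ => n i, a, fun i _ => φ i, hind, hinc, hc⟩

/-- Any branch of an indiscernible tree is a dividing sequence. -/
theorem IndiscernibleFormulaTree.dividingSequence [Nonempty M]
    (h : IndiscernibleFormulaTree A p α) : DividingSequence A p α := by
  obtain ⟨n, a, φ, hind, hinc, hc⟩ := h
  let f : α.ToType → ℕ := fun _ => 0
  exact ⟨fun i => n i (cut f i), fun i => φ i (cut f i), fun i => a i (cut f i) (f i), hc f,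
    fun i => (hind i (cut f i)).formulaDivides (hinc i (cut f i)) (f i)⟩

/-- Finitely many predicates on `ℕ` are constant on the range of some strictly increasing
sequence. -/
theorem exists_strictMono_forall_iff {ι : Type*} {S : Set ι} (hS : S.Finite) (R : ι → ℕ → Prop) :
    ∃ e : ℕ → ℕ, StrictMono e ∧ ∀ Q ∈ S, ∀ m, R Q (e m) ↔ R Q (e 0) := by
  classical
  have : Finite S := hS
  obtain ⟨col, hcol⟩ := Finite.exists_infinite_fiber fun (m : ℕ) (Q : S) => R Q m
  have : Infinite ↥((fun (m : ℕ) (Q : S) => R Q m) ⁻¹' {col}) := hcol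
  let e := Nat.orderEmbeddingOfSet ((fun (m : ℕ) (Q : S) => R Q m) ⁻¹' {col})
  have he : ∀ m, (fun Q : S => R Q (e m)) = col := fun m => by
    have : e m ∈ Set.range e := ⟨m, rfl⟩
    rwa [Nat.orderEmbeddingOfSet_range] at this
  refine ⟨e, e.strictMono, fun Q hQ m => iff_of_eq ?_⟩
  rw [congrFun (he m) ⟨Q, hQ⟩, congrFun (he 0) ⟨Q, hQ⟩]

/-- Needed because the entry to follow at a level depends on the node already reached. -/
theorem exists_branch (E : (i : α.ToType) → (Set.Iio i → ℕ) → ℕ) :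
    ∃ f : α.ToType → ℕ, ∀ i, f i = E i (cut f i) := by
  let f : α.ToType → ℕ := WellFoundedLT.fix fun i prev => E i fun j => prev j j.2
  exact ⟨f, fun i => WellFoundedLT.fix_eq (motive := fun _ => ℕ) _ i⟩

/-- The unknowns are a realization `x` and one row per level. Entry 0 of each row will be the
dividing sequence, and the other entries must have the same type over `A` and the zeroth entries of
earlier rows. Compactness reduces this to finitely many conditions, met inside the tree after
thinning its rows. -/
theorem IsMonster.dividingSequence_of_plusLeDD (hM : IsMonster L M κ) (hX : #X < κ) (hA : #A < κ)
    (hp : IsPartialType A p) (hα : α.card < κ) (h : PlusLeDD p α) : DividingSequence A p α := by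
  classical
  have := hM.nonempty
  obtain ⟨n, a, φ, k, hk, hc⟩ := h
  let Pred (i : α.ToType) : Type w := ((Σ j : Set.Iio i, Fin (n j)) ⊕ Fin (n i) → M) → Prop
  let Y : Type w := X ⊕ Σ i : α.ToType, ℕ × Fin (n i)
  let row (v : Y → M) (i : α.ToType) (m : ℕ) : Fin (n i) → M := fun t => v (Sum.inr ⟨i, m, t⟩)
  let stem (v : Y → M) (i : α.ToType) (m : ℕ) : (Σ j : Set.Iio i, Fin (n j)) ⊕ Fin (n i) → M :=
    Sum.elim (fun z => row v z.1 0 z.2) (row v i m)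
  obtain ⟨v, hv⟩ := hM.exists_realize hA (Y := Y)
    (by
      rw [mk_sum, lift_id, lift_id]
      exact add_lt_of_lt hM.aleph0_lt.le hX
        (hM.card_sigma_lt (by rwa [mk_toType]) fun i => ℕ × Fin (n i)))
    -- Four families of conditions: `x` realizes `p`; `x` satisfies `φ i` at entry 0 of row `i`; row
    -- `i` is `k i`-inconsistent; entries `m` and 0 of row `i` agree on `Q` over the earlier zeroth
    -- entries.
    (ι := (p ⊕ α.ToType) ⊕ (Σ i, {i' : Fin (k i) → ℕ // StrictMono i'}) ⊕
      Σ i, ℕ × {Q : Pred i // DefOver L A Q})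
    (P := Sum.elim
      (Sum.elim (fun ψ v => (ψ : L[[M]].Formula X).Realize (v ∘ Sum.inl))
        fun i v => (φ i).Realize (Sum.elim (v ∘ Sum.inl) (row v i 0)))
      (Sum.elim
        (fun z v => ¬ JointlyRealized (φ z.1) fun y => row v z.1 (z.2.1 y.1) y.2)
        fun z v => z.2.2.1 (stem v z.1 z.2.1) ↔ z.2.2.1 (stem v z.1 0)))
    (by
      rintro ((ψ | i) | ⟨i, i', hi'⟩ | ⟨i, m, Q, hQ⟩)
      · exact (hp.2 _ ψ.2).defOver.comp Sum.inl
      · refine ⟨(φ i).relabel (Sum.elim (fun x => Sum.inr (Sum.inl x))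
          fun t => Sum.inr (Sum.inr ⟨i, 0, t⟩)), fun v => ?_⟩
        rw [Formula.realize_relabel]
        refine iff_of_eq (congrArg (φ i).Realize ?_)
        funext z
        rcases z with z | z <;> rfl
      · exact ((defOver_jointlyRealized (φ i)).comp
          fun y : Fin (k i) × Fin (n i) => (Sum.inr ⟨i, i' y.1, y.2⟩ : Y)).not
      · have hstem : ∀ m, DefOver L A fun v : Y → M => Q (stem v i m) := fun m =>
          (hQ.comp (Sum.elim (fun z => Sum.inr ⟨z.1, 0, z.2⟩) fun t => Sum.inr ⟨i, m, t⟩)).congr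
            fun v => iff_of_eq (congrArg Q (by
              funext z
              rcases z with z | z <;> rfl))
        exact (hstem m).iff (hstem 0))
    (by
      intro I
      have hfin : ∀ i, {z : ℕ × {Q : Pred i // DefOver L A Q} |
          Sum.inr (Sum.inr ⟨i, z⟩) ∈ I}.Finite := fun i => by
        refine Set.Finite.preimage (fun z _ z' _ h => ?_) I.finite_toSet
        simpa using h
      -- Every node's row is thinned so that the finitely many predicates from `I` are constant
      -- along it; the branch `f` then follows the first entry retained at each node.
      choose e hemono he using fun (i : α.ToType) (s : Set.Iio i → ℕ) =>
        exists_strictMono_forall_iff (hfin i) fun z m =>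
          z.2.1 (Sum.elim (fun y => a y.1 (restr s y.1) (s y.1) y.2) (a i s m))
      obtain ⟨f, hf⟩ := exists_branch fun i s => e i s 0
      obtain ⟨x, hx, hx'⟩ := consistent_union_range_iff.1 (hc f)
        ((I.toLeft.toLeft).map ⟨Subtype.val, Subtype.val_injective⟩) (by
          intro ψ hψ
          obtain ⟨ψ, -, rfl⟩ := Finset.mem_map.1 hψ
          exact ψ.2) I.toLeft.toRight
      have hrow : ∀ i, a i (cut f i) (e i (cut f i) 0) = a i (cut f i) (f i) := fun i => by
        rw [← hf i]
      refine ⟨Sum.elim x fun z => a z.1 (cut f z.1) (e z.1 (cut f z.1) z.2.1) z.2.2, ?_⟩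
      rintro ((ψ | i) | ⟨i, i', hi'⟩ | ⟨i, m, Q, hQ⟩) hI
      · exact hx ψ (Finset.mem_map.2 ⟨ψ, by simpa using hI, rfl⟩)
      · have h1 := (realize_inst _ _ _).1 (hx' i (by simpa using hI))
        rw [← hrow] at h1
        exact h1
      · exact (hk i (cut f i)).not_jointlyRealized ((hemono i (cut f i)).comp hi').injective
      · have h1 := he i (cut f i) (m, ⟨Q, hQ⟩) hI m
        have hstem : (fun y : Σ j : Set.Iio i, Fin (n j) =>
            a y.1 (restr (cut f i) y.1) (cut f i y.1) y.2) =
            fun y => a y.1 (cut f y.1) (e y.1 (cut f y.1) 0) y.2 := by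
          funext y
          exact (congrFun (hrow y.1) y.2).symm
        rw [hstem] at h1
        exact h1)
  refine ⟨n, φ, fun i => row v i 0, consistent_union_range_iff.2 fun s hs I =>
    ⟨v ∘ Sum.inl, fun ψ hψ => hv (Sum.inl (Sum.inl ⟨ψ, hs hψ⟩)), fun i _ =>
      (realize_inst _ _ _).2 (hv (Sum.inl (Sum.inr i)))⟩, fun i => ?_⟩
  refine ⟨k i, row v i, fun m => sameType_iff.2 fun P hP => ?_,
    kInconsistent_of_not_jointlyRealized fun i' hi' =>
      hv (Sum.inr (Sum.inl ⟨i, i', hi'⟩))⟩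
  -- The earlier parameters become variables, so that `P` turns into an `A`-definable predicate of
  -- the stem, as in the fourth family.
  rw [← Set.range_sigma_eq_iUnion_range fun z : Σ j : Set.Iio i, Fin (n j) => row v z.1 0 z.2] at hP
  obtain ⟨Q, hQ, hPQ⟩ := hP.exists_params
  rw [hPQ, hPQ]
  exact hv (Sum.inr (Sum.inr ⟨i, m, Q, hQ⟩))

/-- By saturation one tuple `c` realizes `p` and all the dividing formulas; the chain consists of
its types over growing parameter sets. -/
theorem IsMonster.completeDividingChain_of_dividingSequence (hM : IsMonster L M κ) (hX : #X < κ)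
    (hA : #A < κ) (hp : IsPartialType A p) (hα : α.card < κ) (h : DividingSequence A p α) :
    CompleteDividingChain κ A p α := by
  classical
  obtain ⟨n, φ, a, hcons, hdiv⟩ := h
  rw [consistent_union_range_iff] at hcons
  obtain ⟨c, hc⟩ := hM.exists_realize
    (hM.card_union_iUnion_range_lt hA (by rwa [mk_toType]) a) hX (ι := p ⊕ α.ToType)
    (P := Sum.elim (fun ψ v => (ψ : L[[M]].Formula X).Realize v)
      fun i v => (φ i).Realize (Sum.elim v (a i)))
    (by
      rintro (ψ | i)
      · exact (hp.2 _ ψ.2).defOver.mono Set.subset_union_left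
      · exact DefOver.of_realize (φ i) fun t => Or.inr (Set.mem_iUnion.2 ⟨i, t, rfl⟩))
    (by
      intro I
      obtain ⟨x, hx, hx'⟩ := hcons (I.toLeft.map ⟨Subtype.val, Subtype.val_injective⟩) (by
          intro ψ hψ
          obtain ⟨ψ, -, rfl⟩ := Finset.mem_map.1 hψ
          exact ψ.2) I.toRight
      refine ⟨x, ?_⟩
      rintro (ψ | i) hI
      · exact hx ψ (Finset.mem_map.2 ⟨ψ, by simpa using hI, rfl⟩)
      · exact (realize_inst _ _ _).1 (hx' i (by simpa using hI)))
  -- Level `i` itself is included, so that `q i` sees `φ i (x, a i)`, while the earlier sets `B j`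
  -- contain only parameters preceding `a i`.
  let B (i : α.ToType) : Set M := A ∪ ⋃ j : Set.Iic i, Set.range (a j)
  let q (i : α.ToType) : Set (L[[M]].Formula X) := {ψ | FormulaOver (B i) ψ ∧ ψ.Realize c}
  have hBmono : ∀ {i j}, i ≤ j → B i ⊆ B j := fun hij =>
    Set.union_subset_union_right A (Set.iUnion_subset fun l =>
      Set.subset_iUnion_of_subset ⟨l, le_trans l.2 hij⟩ subset_rfl)
  have hqdiv : ∀ i (C : Set M), C ⊆ A ∪ ⋃ j : Set.Iio i, Set.range (a j) →
      TypeDivides C (q i) := by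
    intro i C hC
    refine ⟨n i, φ i, a i, ?_, (hdiv i).mono hC⟩
    obtain ⟨ψ, hψ, hψφ⟩ := (DefOver.of_realize (A := B i) (φ i) fun t =>
      Or.inr (Set.mem_iUnion.2 ⟨⟨i, le_refl i⟩, t, rfl⟩)).exists_formulaOver
    refine ⟨{ψ}, ?_, fun x hx => ?_⟩
    · rw [Finset.coe_singleton, Set.singleton_subset_iff]
      exact ⟨hψ, (hψφ c).1 (hc (Sum.inr i))⟩
    · exact (realize_inst _ _ _).2 ((hψφ x).2 (hx ψ (Finset.mem_singleton_self ψ)))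
  refine ⟨B, q, fun i => ⟨?_, ⟨fun s hs => ⟨c, fun ψ hψ => (hs hψ).2⟩, fun ψ hψ => hψ.1⟩,
    fun ψ hψ => ?_⟩, fun i _ => ⟨?_, Set.subset_union_left, hqdiv i A Set.subset_union_left⟩,
    fun i hi => ⟨?_, ?_, hqdiv i _ ?_⟩⟩
  · exact hM.card_union_iUnion_range_lt hA (card_subtype_toType_lt hα _) fun j : Set.Iic i => a j
  · by_cases h : ψ.Realize c
    · exact Or.inl ⟨hψ, h⟩
    · refine Or.inr ⟨?_, Formula.realize_not.2 h⟩
      obtain ⟨χ, rfl⟩ := hψ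
      exact ⟨χ.not, rfl⟩
  · exact fun ψ hψ => ⟨(hp.2 ψ hψ).mono Set.subset_union_left, hc (Sum.inl ⟨ψ, hψ⟩)⟩
  · exact Set.iUnion_subset fun j ψ hψ => ⟨hψ.1.mono (hBmono (le_of_lt j.2)), hψ.2⟩
  · exact Set.iUnion_subset fun j => hBmono (le_of_lt j.2)
  · exact Set.iUnion_subset fun j => Set.union_subset_union_right A (Set.iUnion_subset fun l =>
      Set.subset_iUnion_of_subset
        ⟨l, Set.mem_Iio.2 (lt_of_le_of_lt (Set.mem_Iic.1 l.2) (Set.mem_Iio.1 j.2))⟩ subset_rfl)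

theorem CompleteDividingChain.partialDividingChain (h : CompleteDividingChain κ A p α) :
    PartialDividingChain κ A p α := by
  obtain ⟨B, q, hBq, hchain⟩ := h
  exact ⟨B, q, fun i => ⟨(hBq i).1, (hBq i).2.1⟩, hchain⟩

/-- The formula extracted from `q i` has its parameters in `B i`. Hence parameters extracted earlier
lie in the union of the earlier `B j`, and dividing over that union passes down to dividing over
them. -/
theorem IsMonster.dividingSequence_of_partialDividingChain (hM : IsMonster L M κ) (hA : #A < κ)
    (hp : IsPartialType A p) (h : PartialDividingChain κ A p α) : DividingSequence A p α := by
  classical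
  obtain ⟨B, q, hBq, hmin, hlim⟩ := h
  have hqmono : ∀ {i j}, i ≤ j → q i ⊆ q j := by
    intro i j hij
    rcases hij.eq_or_lt with rfl | hlt
    · exact subset_rfl
    · exact (Set.subset_iUnion (fun l : Set.Iio j => q l) ⟨i, hlt⟩).trans
        (hlim j fun h => hlt.not_ge (h hlt.le)).1
  have hBmono : ∀ {i j}, i ≤ j → B i ⊆ B j := by
    intro i j hij
    rcases hij.eq_or_lt with rfl | hlt
    · exact subset_rfl
    · exact (Set.subset_iUnion (fun l : Set.Iio j => B l) ⟨i, hlt⟩).trans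
        (hlim j fun h => hlt.not_ge (h hlt.le)).2.1
  have hbot : ∀ i : α.ToType, ∃ j ≤ i, IsMin j := fun i => by
    obtain ⟨j, -, hj⟩ := wellFounded_lt.has_min (Set.univ : Set α.ToType) ⟨i, trivial⟩
    exact ⟨j, not_lt.1 (hj i trivial), fun l _ => not_lt.1 (hj l trivial)⟩
  have hpq : ∀ i, p ⊆ q i := fun i => by
    obtain ⟨j, hji, hj⟩ := hbot i
    exact (hmin j hj).1.trans (hqmono hji)
  -- Adding `A` to the base treats both cases uniformly: at the minimum the union is empty, and
  -- elsewhere it already contains `A`.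
  have hex : ∀ i, ∃ (m : ℕ) (θ : L.Formula (X ⊕ Fin m)) (b : Fin m → M),
      (∀ t, b t ∈ B i) ∧ Implies (q i) (inst θ b) ∧
        FormulaDivides (A ∪ ⋃ j : Set.Iio i, B j) θ b := by
    intro i
    by_cases hi : IsMin i
    · have hempty : A ∪ ⋃ j : Set.Iio i, B j = A := by
        refine Set.union_eq_self_of_subset_right (Set.iUnion_subset fun j => ?_)
        exact absurd j.2 (not_lt.2 (hi (le_of_lt j.2)))
      rw [hempty]
      exact hM.exists_formulaDivides hA (hBq i).2.2 (hmin i hi).2.2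
    · have hsub : A ∪ ⋃ j : Set.Iio i, B j = ⋃ j : Set.Iio i, B j := by
        refine Set.union_eq_self_of_subset_left ?_
        obtain ⟨j, hji, hj⟩ := hbot i
        have hlt : j < i := lt_of_le_of_ne hji fun h => hi (h ▸ hj)
        exact (hmin j hj).2.1.trans (Set.subset_iUnion (fun l : Set.Iio i => B l) ⟨j, hlt⟩)
      rw [hsub]
      exact hM.exists_formulaDivides ((mk_le_mk_of_subset (hlim i hi).2.1).trans_lt (hBq i).1)
        (hBq i).2.2 (hlim i hi).2.2
  choose n θ b hbB himp hdiv using hex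
  refine ⟨n, θ, b, consistent_union_range_iff.2 fun s hs I => ?_, fun i => (hdiv i).mono ?_⟩
  · choose S hSq hS using himp
    rcases I.eq_empty_or_nonempty with rfl | hne
    · obtain ⟨x, hx⟩ := hp.1 s hs
      exact ⟨x, hx, by simp⟩
    -- The type at the largest index in `I` contains `p` and every finite set used to imply the
    -- formulas indexed by `I`.
    · obtain ⟨x, hx⟩ := (hBq (I.max' hne)).2.1 (s ∪ I.biUnion S) (by
        intro ψ hψ
        rw [Finset.mem_coe, Finset.mem_union, Finset.mem_biUnion] at hψ
        rcases hψ with hψ | ⟨i, hi, hψ⟩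
        · exact hpq _ (hs hψ)
        · exact hqmono (I.le_max' i hi) (hSq i hψ))
      exact ⟨x, fun ψ hψ => hx ψ (Finset.mem_union_left _ hψ), fun i hi =>
        hS i x fun ψ hψ => hx ψ (Finset.mem_union_right _ (Finset.mem_biUnion.2 ⟨i, hi, hψ⟩))⟩
  · refine Set.union_subset_union_right A (Set.iUnion_mono fun j => ?_)
    rintro _ ⟨t, rfl⟩
    exact hbB j t

theorem IsMonster.tfae_plusLeDD (hM : IsMonster L M κ) (hX : #X < κ) (hA : #A < κ)
    (hp : IsPartialType A p) (hα : α.card < κ) :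
    List.TFAE
      [PlusLeDD p α, IndiscernibleTree A p α, IndiscernibleFormulaTree A p α,
        DividingSequence A p α, CompleteDividingChain κ A p α, PartialDividingChain κ A p α] := by
  have := hM.nonempty
  tfae_have 1 → 4 := hM.dividingSequence_of_plusLeDD hX hA hp hα
  tfae_have 4 → 1 := hM.plusLeDD_of_dividingSequence hA hp hα
  tfae_have 4 → 2 := hM.indiscernibleTree_of_dividingSequence hA hp hα
  tfae_have 2 → 3 := IndiscernibleTree.indiscernibleFormulaTree
  tfae_have 3 → 4 := IndiscernibleFormulaTree.dividingSequence
  tfae_have 4 → 5 := hM.completeDividingChain_of_dividingSequence hX hA hp hα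
  tfae_have 5 → 6 := CompleteDividingChain.partialDividingChain
  tfae_have 6 → 4 := hM.dividingSequence_of_partialDividingChain hA hp
  tfae_finish

end Equivalences

end DividingDepth

theorem mainTheorem1 {L : FirstOrder.Language.{u, v}} {M : Type w} [L.Structure M]
    (κ : Cardinal.{w}) (hM : DividingDepth.IsMonster L M κ)
    {X : Type w} (hX : #X < κ)
    (A : Set M) (hA : #A < κ)
    (p : Set (L[[M]].Formula X)) (hp : DividingDepth.IsPartialType A p)
    (α : Ordinal.{w}) (hα : α.card < κ) :
    List.TFAE
      [DividingDepth.PlusLeDD p α,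
        DividingDepth.IndiscernibleTree A p α,
        DividingDepth.IndiscernibleFormulaTree A p α,
        DividingDepth.DividingSequence A p α,
        DividingDepth.CompleteDividingChain κ A p α,
        DividingDepth.PartialDividingChain κ A p α] ∧
    ∀ B : Set M, #B < κ → DividingDepth.IsPartialType B p →
      (DividingDepth.IndiscernibleTree A p α ↔ DividingDepth.IndiscernibleTree B p α) ∧
      (DividingDepth.IndiscernibleFormulaTree A p α ↔
        DividingDepth.IndiscernibleFormulaTree B p α) ∧
      (DividingDepth.DividingSequence A p α ↔ DividingDepth.DividingSequence B p α) ∧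
      (DividingDepth.CompleteDividingChain κ A p α ↔
        DividingDepth.CompleteDividingChain κ B p α) ∧
      (DividingDepth.PartialDividingChain κ A p α ↔
        DividingDepth.PartialDividingChain κ B p α) := by
  have key := fun {A : Set M} (hA : #A < κ) (hp : DividingDepth.IsPartialType A p) =>
    hM.tfae_plusLeDD hX hA hp hα
  refine ⟨key hA hp, fun B hB hpB => ⟨?_, ?_, ?_, ?_, ?_⟩⟩
  -- Each comparison of `A` with `B` goes through entry 0, `PlusLeDD p α`, which depends on neither.
  · exact ((key hA hp).out 1 0).trans ((key hB hpB).out 0 1)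
  · exact ((key hA hp).out 2 0).trans ((key hB hpB).out 0 2)
  · exact ((key hA hp).out 3 0).trans ((key hB hpB).out 0 3)
  · exact ((key hA hp).out 4 0).trans ((key hB hpB).out 0 4)
  · exact ((key hA hp).out 5 0).trans ((key hB hpB).out 0 5)
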